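/- Let $(X,\mathsf d)$ be a complete separable metric space, $\mathfrak m\neq 0$ a non-negative Radon measure on $X$, and $p\in[1,\infty]$. **Measurable Banach bundles.** A measurable Banach bundle $\mathbb T$ over $X$ consists of a Borel partition $(E_n)_{n\in\mathbb N}$ of $X$, the total space $T=\bigsqcup_n E_n\times\mathbb R^n$ (a subset of $T$ is measurable iff its trace on each $E_n\times\mathbb R^n$ is Borel) with its projection $\pi:T\to X$, and a measurable function $\mathsf n:T\to[0,\infty)$ such that $\mathsf n(x,\cdot)$ is a norm on the fibre $T_x=\pi^{-1}\{x\}\cong\mathbb R^n$ for a.e. $x\in E_n$, $n\in\mathbb N$. A morphism $\mathbb T_1\to\mathbb T_2$ is a measurable map $\varphi:T_1\to T_2$ with $\pi_2\circ\varphi=\pi_1$ which for a.e. $x$ is linear and $1$-Lipschitz from $((T_1)_x,\mathsf n_1(x,\cdot))$ to $((T_2)_x,\mathsf n_2(x,\cdot))$; two such maps are identified if they agree on the fibre over a.e. $x$. This gives the category $\mathbf{MBB}(X)$. **Modules.** An $L^p(\mathfrak m)$-normed $L^\infty(\mathfrak m)$-module is an $L^\infty(\mathfrak m)$-module $M$ with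 a map $|\cdot|:M\to L^p(\mathfrak m)$ such that $|v|\ge 0$ and $|f\cdot v|=|f|\,|v|$ a.e., such that $\|v\|:=\||v|\|_{L^p(\mathfrak m)}$ is a complete norm on $M$, and having the following two properties. *Locality:* if $\chi_{A_n}v=0$ for a sequence of Borel sets $A_n$, then $\chi_{\bigcup_nA_n}v=0$. *Glueing:* if $(A_n)$ are pairwise disjoint Borel sets, $(v_n)\subseteq M$ and $\|\sum_{i<n}\chi_{A_i}v_i\|\le C$ for all $n$, there is $w\in M$ with $\chi_{A_n}w=\chi_{A_n}v_n$ for all $n$ and $\|w\|\le C$. A morphism $M\to N$ is an $L^\infty(\mathfrak m)$-linear map $\Phi$ with $|\Phi(v)|\le|v|$ a.e. for all $v\in M$. For a Borel set $A$, $M$ has dimension $n\in\mathbb N$ on $A$ if there are $v_1,\dots,v_n\in M$ which are independent on $A$ ($\chi_A\sum_if_iv_i=0$ with $f_i\in L^\infty(\mathfrak m)$ implies $\chi_Af_i=0$ for all $i$) and span $M$ on $A$ (for every $w\in M$ there are a countable Borel partition $(B_k)$ of $A$ and $f_{k,i}\in L^\infty(\mathfrak m)$ with $\chi_{B_k}w=\chi_{B_k}\sum_if_{k,i}v_i$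 for all $k$). $M$ is *proper* if there is a Borel partition $(E_n)_{n\in\mathbb N\cup\{\infty\}}$ of $X$ such that $M$ has dimension $n$ on $E_n$ for every $n\in\mathbb N$ with $\mathfrak m(E_n)>0$, $M$ does not have dimension $n$ on $A$ for any $n\in\mathbb N$ and any Borel $A\subseteq E_\infty$ with $\mathfrak m(A)>0$, and $\mathfrak m(E_\infty)=0$. Let $\mathbf{NMod}^p_{\rm pr}(X)$ be the category of proper $L^p(\mathfrak m)$-normed $L^\infty(\mathfrak m)$-modules and their morphisms. **Sections.** For a measurable Banach bundle $\mathbb T$, let $\Gamma_0(\mathbb T)$ be the set of measurable maps $s:X\to T$ with $\pi\circ s=\mathrm{id}_X$, up to a.e. equality, with pointwise operations and $|s|:=\mathsf n\circ s$, and let $\Gamma_p(\mathbb T):=\{s\in\Gamma_0(\mathbb T): |s|\in L^p(\mathfrak m)\}$. For a morphism $\varphi:\mathbb T_1\to\mathbb T_2$ let $\Gamma_p(\varphi)(s):=\varphi\circ s$ for $s\in\Gamma_p(\mathbb T_1)$. **Theorem.** For every measurable Banach bundle $\mathbb T$, $\Gamma_p(\mathbb T)$ is a proper $L^p(\mathfrak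 m)$-normed $L^\infty(\mathfrak m)$-module, and the $L^p$-section functor $\Gamma_p:\mathbf{MBB}(X)\to\mathbf{NMod}^p_{\rm pr}(X)$ is an equivalence of categories. -/

import Mathlib

open MeasureTheory CategoryTheory
open scoped ENNReal

universe u

noncomputable section

namespace NormedModules

variable {X : Type u} [MeasurableSpace X]

/-! ### The rings `L⁰(m)` and `L^∞(m)`

`L⁰(m)` is Mathlib's ring `X →ₘ[m] ℝ` of measurable functions up to a.e. equality. -/

instance (m : Measure X) : CommRing (X →ₘ[m] ℝ) :=
  { AEEqFun.instAddCommGroup, AEEqFun.instCommMonoid with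
    left_distrib := by
      intro a b c
      induction a, b, c using AEEqFun.induction_on₃ with | _ a ha b hb c hc => ?_
      simp only [AEEqFun.mk_add_mk, AEEqFun.mk_mul_mk, mul_add]
    right_distrib := by
      intro a b c
      induction a, b, c using AEEqFun.induction_on₃ with | _ a ha b hb c hc => ?_
      simp only [AEEqFun.mk_add_mk, AEEqFun.mk_mul_mk, add_mul]
    zero_mul := by
      intro a
      induction a using AEEqFun.induction_on with | _ a ha => ?_
      simp only [AEEqFun.zero_def, AEEqFun.mk_mul_mk]
      simp only [Pi.mul_def, zero_mul]
    mul_zero := by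
      intro a
      induction a using AEEqFun.induction_on with | _ a ha => ?_
      simp only [AEEqFun.zero_def, AEEqFun.mk_mul_mk]
      simp only [Pi.mul_def, mul_zero] }

/-- `L^∞(m)` as a subring of `L⁰(m)`. -/
def Linf (m : Measure X) : Subring (X →ₘ[m] ℝ) where
  carrier := {f | f ∈ Lp ℝ ∞ m}
  zero_mem' := (Lp ℝ ∞ m).zero_mem
  add_mem' := (Lp ℝ ∞ m).add_mem
  neg_mem' := (Lp ℝ ∞ m).neg_mem
  one_mem' := by
    refine Lp.mem_Lp_iff_memLp.2 ?_
    exact (memLp_congr_ae (AEEqFun.coeFn_one (μ := m) (β := ℝ))).2 (memLp_top_const (1 : ℝ))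
  mul_mem' := by
    intro f g hf hg
    refine Lp.mem_Lp_iff_memLp.2 ?_
    exact (memLp_congr_ae (AEEqFun.coeFn_mul f g)).2
      ((Lp.mem_Lp_iff_memLp.1 hg).mul (p := ∞) (q := ∞) (r := ∞) (Lp.mem_Lp_iff_memLp.1 hf))

/-- The characteristic function `χ_A` of a measurable set `A`, as an element of `L^∞(m)`. -/
def chi (m : Measure X) {A : Set X} (hA : MeasurableSet A) : Linf m :=
  ⟨AEEqFun.mk (A.indicator fun _ => (1 : ℝ))
      ((measurable_const.indicator hA).aestronglyMeasurable),
    Lp.mem_Lp_iff_memLp.2 ((memLp_congr_ae (AEEqFun.coeFn_mk _ _)).2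
      ((memLp_top_const (1 : ℝ)).indicator hA))⟩

/-! ### `L^p`-normed `L^∞`-modules -/

/-- An `L^∞(m)`-module `M` with a norm and a pointwise norm `|·| : M → L^p(m)` such that
`|v| ≥ 0`, `|f • v| = |f| |v|` and `‖v‖ = ‖ |v| ‖_{L^p}`. (The real vector space structure is the
one obtained by restricting scalars to the constant functions.) The remaining requirements of
the notion of an `L^p`-normed `L^∞`-module are collected in `PreNMod.IsNMod`. -/
structure PreNMod (m : Measure X) (p : ℝ≥0∞) [Fact (1 ≤ p)] where
  carrier : Type u
  [normedAddCommGroup : NormedAddCommGroup carrier]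
  [module : Module (Linf m) carrier]
  pnorm : carrier → Lp ℝ p m
  pnorm_nonneg : ∀ v, 0 ≤ pnorm v
  pnorm_smul : ∀ (f : Linf m) (v : carrier),
    (pnorm (f • v) : X →ₘ[m] ℝ) = |(f : X →ₘ[m] ℝ)| * (pnorm v : X →ₘ[m] ℝ)
  norm_eq : ∀ v, ‖v‖ = ‖pnorm v‖

namespace PreNMod

variable {m : Measure X} {p : ℝ≥0∞} [Fact (1 ≤ p)]

instance : CoeSort (PreNMod m p) (Type u) := ⟨carrier⟩
instance (M : PreNMod m p) : NormedAddCommGroup M := M.normedAddCommGroup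
instance (M : PreNMod m p) : Module (Linf m) M := M.module

/-- Module morphisms: `L^∞(m)`-linear maps with `|Φ(v)| ≤ |v|` a.e. for every `v`. -/
@[ext]
structure Hom (M N : PreNMod m p) where
  toLinearMap : M →ₗ[Linf m] N
  pnorm_le : ∀ v, N.pnorm (toLinearMap v) ≤ M.pnorm v

instance : Category (PreNMod m p) where
  Hom := Hom
  id M := ⟨LinearMap.id, fun _ => le_rfl⟩
  comp f g := ⟨g.toLinearMap.comp f.toLinearMap,
    fun v => (g.pnorm_le (f.toLinearMap v)).trans (f.pnorm_le v)⟩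

/-- The locality property. -/
def Locality (M : PreNMod m p) : Prop :=
  ∀ (v : M) (A : ℕ → Set X) (hA : ∀ n, MeasurableSet (A n)),
    (∀ n, chi m (hA n) • v = 0) → chi m (MeasurableSet.iUnion hA) • v = 0

/-- The glueing property: a sequence of elements can be glued along pairwise disjoint Borel sets
as soon as the partial sums stay bounded in norm. -/
def Glueing (M : PreNMod m p) : Prop :=
  ∀ (v : ℕ → M) (A : ℕ → Set X) (hA : ∀ n, MeasurableSet (A n)),
    Pairwise (fun i j => Disjoint (A i) (A j)) →
    ∀ C : ℝ, (∀ n, ‖∑ i ∈ Finset.range n, chi m (hA i) • v i‖ ≤ C) →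
      ∃ w : M, (∀ n, chi m (hA n) • w = chi m (hA n) • v n) ∧ ‖w‖ ≤ C

/-- `M` is an `L^p(m)`-normed `L^∞(m)`-module: it is a Banach space having the locality and the
glueing property. -/
structure IsNMod (M : PreNMod m p) : Prop where
  complete : CompleteSpace M
  locality : M.Locality
  glueing : M.Glueing

/-- `v₁, …, vₙ` are independent on `A`: `∑ fᵢ vᵢ = 0` on `A` implies `fᵢ = 0` on `A`. -/
def IndependentOn (M : PreNMod m p) {n : ℕ} (v : Fin n → M) {A : Set X}
    (hA : MeasurableSet A) : Prop :=
  ∀ f : Fin n → Linf m, chi m hA • ∑ i, f i • v i = 0 → ∀ i, chi m hA * f i = 0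

/-- `v₁, …, vₙ` span `M` on `A`: every `w ∈ M` is, on each piece of some countable Borel partition
of `A` (depending on `w`), an `L^∞(m)`-linear combination of `v₁, …, vₙ`. -/
def SpansOn (M : PreNMod m p) {n : ℕ} (v : Fin n → M) (A : Set X) : Prop :=
  ∀ w : M, ∃ (B : ℕ → Set X) (hB : ∀ k, MeasurableSet (B k)),
    Pairwise (fun i j => Disjoint (B i) (B j)) ∧ (⋃ k, B k) = A ∧
      ∀ k, ∃ f : Fin n → Linf m, chi m (hB k) • w = chi m (hB k) • ∑ i, f i • v i

/-- `M` has dimension `n` on `A`: it has a local basis on `A` made of `n` elements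
(for `n = 0` this says that `χ_A • M = 0`). -/
def HasDimOn (M : PreNMod m p) (n : ℕ) {A : Set X} (hA : MeasurableSet A) : Prop :=
  ∃ v : Fin n → M, M.IndependentOn v hA ∧ M.SpansOn v A

/-- A Borel partition `(E_n)_{n ∈ ℕ ∪ {∞}}` of `X` is a dimensional decomposition of `M` if `M`
has dimension `n` on `E_n` whenever `n < ∞` and `m(E_n) > 0`, and `M` has no finite local basis
on any non-negligible Borel subset of `E_∞`. -/
structure IsDimDecomposition (M : PreNMod m p) (E : ℕ∞ → Set X) : Prop where
  measurableSet : ∀ n, MeasurableSet (E n)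
  disjoint : Pairwise (fun i j => Disjoint (E i) (E j))
  iUnion_eq : (⋃ n, E n) = Set.univ
  hasDimOn : ∀ n : ℕ, 0 < m (E n) → M.HasDimOn n (measurableSet n)
  infinite : ∀ (A : Set X) (hA : MeasurableSet A), A ⊆ E ⊤ → 0 < m A → ∀ n, ¬ M.HasDimOn n hA

/-- `M` is proper: `m(E_∞) = 0` for its dimensional decomposition. -/
def IsProper (M : PreNMod m p) : Prop :=
  ∃ E : ℕ∞ → Set X, M.IsDimDecomposition E ∧ m (E ⊤) = 0

end PreNMod

/-- The proper `L^p(m)`-normed `L^∞(m)`-modules. -/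
def isProperNMod (m : Measure X) (p : ℝ≥0∞) [Fact (1 ≤ p)] : ObjectProperty (PreNMod m p) :=
  fun M => M.IsNMod ∧ M.IsProper

/-- The category of proper `L^p(m)`-normed `L^∞(m)`-modules and module morphisms. -/
abbrev NModPr (m : Measure X) (p : ℝ≥0∞) [Fact (1 ≤ p)] := (isProperNMod m p).FullSubcategory

/-! ### Measurable Banach bundles -/

/-- The total space `⨆ₙ Eₙ × ℝⁿ`, where `Eₙ = {x | d x = n}`. -/
@[ext]
structure Total (d : X → ℕ) where
  base : X
  vec : Fin (d base) → ℝ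

namespace Total

variable {d : X → ℕ}

/-- The inclusion of `Eₙ × ℝⁿ` in the total space. -/
def incl (d : X → ℕ) (n : ℕ) (z : {x // d x = n} × (Fin n → ℝ)) : Total d :=
  ⟨z.1, fun i => z.2 (Fin.cast z.1.2 i)⟩

/-- A set is measurable in the total space iff its trace on each `Eₙ × ℝⁿ` is Borel. -/
instance : MeasurableSpace (Total d) :=
  ⨅ n, MeasurableSpace.map (incl d n) inferInstance

lemma measurableSet_iff {S : Set (Total d)} :
    MeasurableSet S ↔ ∀ n, MeasurableSet (incl d n ⁻¹' S) :=
  MeasurableSpace.measurableSet_iInf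

lemma measurable_of_incl {β : Type*} [MeasurableSpace β] {f : Total d → β}
    (h : ∀ n, Measurable (f ∘ incl d n)) : Measurable f :=
  fun _ hS => measurableSet_iff.2 fun n => h n hS

/-- The `i`-th coordinate of the fibre component, extended by `0` when `i` is out of range. -/
def coord (i : ℕ) (t : Total d) : ℝ := if h : i < d t.base then t.vec ⟨i, h⟩ else 0

lemma measurable_base : Measurable (base : Total d → X) :=
  measurable_of_incl fun _ => measurable_subtype_coe.comp measurable_fst

lemma measurable_coord (i : ℕ) : Measurable (coord i : Total d → ℝ) := by
  refine measurable_of_incl fun n => ?_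
  by_cases h : i < n
  · have : (coord i ∘ incl d n) = fun z => z.2 ⟨i, h⟩ := by
      funext z
      have hz : i < d z.1.1 := by rw [z.1.2]; exact h
      change (if h : i < d z.1.1 then z.2 (Fin.cast z.1.2 ⟨i, h⟩) else 0) = _
      rw [dif_pos hz]
      rfl
    rw [this]
    exact (measurable_pi_apply _).comp measurable_snd
  · have : (coord i ∘ incl d n) = fun _ => 0 := by
      funext z
      have hz : ¬ i < d z.1.1 := by rw [z.1.2]; exact h
      simp [coord, incl, hz]
    rw [this]
    exact measurable_const

lemma measurable_iff (hd : Measurable d) {β : Type*} [MeasurableSpace β] {f : β → Total d} :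
    Measurable f ↔ Measurable (fun y => (f y).base) ∧ ∀ i, Measurable fun y => coord i (f y) := by
  refine ⟨fun h => ⟨measurable_base.comp h, fun i => (measurable_coord i).comp h⟩, ?_⟩
  rintro ⟨hb, hc⟩ S hS
  have hA : ∀ n, MeasurableSet {y | d (f y).base = n} := fun n =>
    (hd.comp hb) (measurableSet_singleton n)
  have key : f ⁻¹' S = ⋃ n, Subtype.val ''
      ((fun y : {y | d (f y).base = n} =>
        ((⟨(f y).base, y.2⟩, fun i => coord i (f y)) : {x // d x = n} × (Fin n → ℝ))) ⁻¹'
          (incl d n ⁻¹' S)) := by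
    ext y
    have hy : ∀ h : d (f y).base = d (f y).base,
        incl d (d (f y).base) (⟨(f y).base, h⟩, fun i => coord i (f y)) = f y := by
      intro h
      refine Total.ext rfl (heq_of_eq ?_)
      funext i
      have hi : (i : ℕ) < d (f y).base := i.2
      simp only [incl, coord, Fin.val_cast, hi, dite_true]
      rfl
    simp only [Set.mem_preimage, Set.mem_iUnion, Set.mem_image, Subtype.exists,
      Set.mem_ofPred_eq, exists_and_right, exists_eq_right]
    constructor
    · intro h
      exact ⟨_, rfl, by rw [hy]; exact h⟩
    · rintro ⟨n, rfl, h⟩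
      rwa [hy] at h
  rw [key]
  refine MeasurableSet.iUnion fun n => (hA n).subtype_image ?_
  refine Measurable.prodMk ?_ ?_ (measurableSet_iff.1 hS n)
  · exact (hb.comp measurable_subtype_coe).subtype_mk
  · exact measurable_pi_lambda _ fun i => (hc i).comp measurable_subtype_coe

end Total

/-- `g` is a norm on the real vector space `V`. -/
structure IsNormFun {V : Type*} [AddCommGroup V] [Module ℝ V] (g : V → ℝ) : Prop where
  add_le : ∀ v w, g (v + w) ≤ g v + g w
  smul_eq : ∀ (c : ℝ) v, g (c • v) = |c| * g v
  eq_zero : ∀ v, g v = 0 → v = 0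

/-- A measurable Banach bundle over `(X, m)`. The Borel partition `(Eₙ)` of `X` is encoded by the
measurable function `dim`, via `Eₙ = {x | dim x = n}`; the fibre over `x ∈ Eₙ` is `ℝⁿ`. -/
structure MBB (m : Measure X) where
  dim : X → ℕ
  measurable_dim : Measurable dim
  nrm : Total dim → ℝ
  measurable_nrm : Measurable nrm
  nrm_nonneg : ∀ t, 0 ≤ nrm t
  ae_isNormFun : ∀ᵐ x ∂m, IsNormFun fun v : Fin (dim x) → ℝ => nrm ⟨x, v⟩

namespace MBB

variable {m : Measure X}

/-- The fibre over `x`. -/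
abbrev Fiber (T : MBB m) (x : X) : Type := Fin (T.dim x) → ℝ

/-- A pre-morphism: a measurable map between the total spaces which covers the identity of `X`
(hence is given by its restrictions `app x` to the fibres) and which is linear and 1-Lipschitz on
the fibre over a.e. `x`. -/
structure PreHom (T₁ T₂ : MBB m) where
  app : ∀ x, T₁.Fiber x → T₂.Fiber x
  measurable : Measurable fun t : Total T₁.dim => (⟨t.base, app t.base t.vec⟩ : Total T₂.dim)
  ae_linear : ∀ᵐ x ∂m, IsLinearMap ℝ (app x)
  ae_lipschitz : ∀ᵐ x ∂m, ∀ v w : T₁.Fiber x,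
    T₂.nrm ⟨x, app x v - app x w⟩ ≤ T₁.nrm ⟨x, v - w⟩

/-- Two pre-morphisms are equivalent if they agree on the fibre over a.e. `x`. -/
instance preHomSetoid (T₁ T₂ : MBB m) : Setoid (PreHom T₁ T₂) where
  r φ ψ := ∀ᵐ x ∂m, φ.app x = ψ.app x
  iseqv :=
    { refl := fun _ => Filter.Eventually.of_forall fun _ => rfl
      symm := fun h => h.mono fun _ hx => hx.symm
      trans := fun h₁ h₂ => h₁.mp (h₂.mono fun _ hx hy => hy.trans hx) }

/-- The identity pre-morphism. -/
def PreHom.id (T : MBB m) : PreHom T T where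
  app _ v := v
  measurable := measurable_id
  ae_linear := Filter.Eventually.of_forall fun _ => ⟨fun _ _ => rfl, fun _ _ => rfl⟩
  ae_lipschitz := Filter.Eventually.of_forall fun _ _ _ => le_rfl

/-- Composition of pre-morphisms. -/
def PreHom.comp {T₁ T₂ T₃ : MBB m} (φ : PreHom T₁ T₂) (ψ : PreHom T₂ T₃) : PreHom T₁ T₃ where
  app x v := ψ.app x (φ.app x v)
  measurable := ψ.measurable.comp φ.measurable
  ae_linear := by
    filter_upwards [φ.ae_linear, ψ.ae_linear] with x hφ hψ
    exact ⟨fun v w => by rw [hφ.map_add, hψ.map_add], fun c v => by rw [hφ.map_smul, hψ.map_smul]⟩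
  ae_lipschitz := by
    filter_upwards [φ.ae_lipschitz, ψ.ae_lipschitz] with x hφ hψ v w
    exact (hψ _ _).trans (hφ _ _)

/-- The category of measurable Banach bundles: arrows are equivalence classes of pre-morphisms. -/
instance : Category (MBB m) where
  Hom T₁ T₂ := Quotient (preHomSetoid T₁ T₂)
  id T := ⟦PreHom.id T⟧
  comp {T₁ T₂ T₃} φ ψ := Quotient.map₂ PreHom.comp
    (fun _ _ h _ _ h' => by
      filter_upwards [h, h'] with x hx hx'
      funext v
      simp only [PreHom.comp, hx, hx']) φ ψ
  id_comp φ := by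
    induction φ using Quotient.inductionOn
    rfl
  comp_id φ := by
    induction φ using Quotient.inductionOn
    rfl
  assoc φ ψ χ := by
    induction φ using Quotient.inductionOn
    induction ψ using Quotient.inductionOn
    induction χ using Quotient.inductionOn
    rfl

/-! ### Sections -/

variable (T : MBB m)

lemma measurable_section_iff {s : ∀ x, T.Fiber x} :
    Measurable (fun x => (⟨x, s x⟩ : Total T.dim)) ↔
      ∀ i, Measurable fun x => Total.coord i (⟨x, s x⟩ : Total T.dim) := by
  rw [Total.measurable_iff T.measurable_dim]
  exact and_iff_right measurable_id

/-- The measurable sections of the projection `T → X`. -/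
def sections : AddSubgroup (∀ x, T.Fiber x) where
  carrier := {s | Measurable fun x => (⟨x, s x⟩ : Total T.dim)}
  zero_mem' := by
    refine T.measurable_section_iff.2 fun i => ?_
    have : (fun x => Total.coord i (⟨x, (0 : ∀ x, T.Fiber x) x⟩ : Total T.dim)) = fun _ => 0 := by
      funext x
      simp [Total.coord]
    rw [this]
    exact measurable_const
  add_mem' {s t} hs ht := by
    refine T.measurable_section_iff.2 fun i => ?_
    have : (fun x => Total.coord i (⟨x, (s + t) x⟩ : Total T.dim)) = fun x =>
        Total.coord i (⟨x, s x⟩ : Total T.dim) + Total.coord i (⟨x, t x⟩ : Total T.dim) := by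
      funext x
      by_cases h : i < T.dim x <;> simp [Total.coord, h]
    rw [this]
    exact (T.measurable_section_iff.1 hs i).add (T.measurable_section_iff.1 ht i)
  neg_mem' {s} hs := by
    refine T.measurable_section_iff.2 fun i => ?_
    have : (fun x => Total.coord i (⟨x, (-s) x⟩ : Total T.dim)) = fun x =>
        -Total.coord i (⟨x, s x⟩ : Total T.dim) := by
      funext x
      by_cases h : i < T.dim x <;> simp [Total.coord, h]
    rw [this]
    exact (T.measurable_section_iff.1 hs i).neg

/-- The sections vanishing a.e. -/
def nullSections : AddSubgroup T.sections where
  carrier := {s | ∀ᵐ x ∂m, s.1 x = 0}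
  zero_mem' := by
    change ∀ᵐ x ∂m, (0 : ∀ x, T.Fiber x) x = 0
    exact Filter.Eventually.of_forall fun _ => rfl
  add_mem' {s t} hs ht := by
    change ∀ᵐ x ∂m, s.1 x + t.1 x = 0
    change ∀ᵐ x ∂m, s.1 x = 0 at hs
    change ∀ᵐ x ∂m, t.1 x = 0 at ht
    filter_upwards [hs, ht] with x hx hy
    rw [hx, hy, add_zero]
  neg_mem' {s} hs := by
    change ∀ᵐ x ∂m, -s.1 x = 0
    change ∀ᵐ x ∂m, s.1 x = 0 at hs
    filter_upwards [hs] with x hx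
    rw [hx, neg_zero]

/-- `Γ₀(T)`: the measurable sections of `T` up to a.e. equality. -/
def Gamma0 : Type u := T.sections ⧸ T.nullSections

instance : AddCommGroup T.Gamma0 :=
  inferInstanceAs (AddCommGroup (T.sections ⧸ T.nullSections))

variable {T}

/-- The equivalence class of a section. -/
def Gamma0.mk : T.sections →+ T.Gamma0 := QuotientAddGroup.mk' T.nullSections

lemma Gamma0.mk_eq_mk {s t : T.sections} :
    Gamma0.mk s = Gamma0.mk t ↔ ∀ᵐ x ∂m, s.1 x = t.1 x := by
  have h : Gamma0.mk s = Gamma0.mk t ↔ -s + t ∈ T.nullSections := QuotientAddGroup.eq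
  rw [h]
  change (∀ᵐ x ∂m, -s.1 x + t.1 x = 0) ↔ _
  refine Filter.eventually_congr (Filter.Eventually.of_forall fun x => ?_)
  rw [neg_add_eq_zero]

lemma Gamma0.ind {P : T.Gamma0 → Prop} (h : ∀ s, P (Gamma0.mk s)) (s : T.Gamma0) : P s :=
  QuotientAddGroup.induction_on s h

/-- The pointwise product of a measurable function and a section. -/
def smulSection (f : X → ℝ) (hf : Measurable f) : T.sections →+ T.sections where
  toFun s := ⟨fun x => f x • s.1 x, by
    refine T.measurable_section_iff.2 fun i => ?_
    have : (fun x => Total.coord i (⟨x, f x • s.1 x⟩ : Total T.dim)) = fun x =>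
        f x * Total.coord i (⟨x, s.1 x⟩ : Total T.dim) := by
      funext x
      by_cases h : i < T.dim x <;> simp [Total.coord, h]
    rw [this]
    exact hf.mul (T.measurable_section_iff.1 s.2 i)⟩
  map_zero' := Subtype.ext (funext fun _ => smul_zero _)
  map_add' _ _ := Subtype.ext (funext fun _ => smul_add _ _ _)

/-- Multiplication of (classes of) sections by a function in `L⁰(m)`, defined through
representatives. -/
def smulHom (f : X →ₘ[m] ℝ) : T.Gamma0 →+ T.Gamma0 :=
  QuotientAddGroup.map _ _ (smulSection (T := T) f f.stronglyMeasurable.measurable) (by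
    intro s hs
    change ∀ᵐ x ∂m, f x • s.1 x = 0
    filter_upwards [hs] with x hx
    rw [hx, smul_zero])

instance : SMul (X →ₘ[m] ℝ) T.Gamma0 := ⟨fun f s => smulHom f s⟩

lemma smul_mk (f : X →ₘ[m] ℝ) (s : T.sections) :
    f • Gamma0.mk s = Gamma0.mk (smulSection f f.stronglyMeasurable.measurable s) := rfl

instance : Module (X →ₘ[m] ℝ) T.Gamma0 where
  smul_zero f := map_zero (smulHom f)
  smul_add f := map_add (smulHom f)
  one_smul s := by
    induction s using Gamma0.ind with | _ s => ?_
    rw [smul_mk, Gamma0.mk_eq_mk]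
    filter_upwards [AEEqFun.coeFn_one (μ := m) (β := ℝ)] with x hx
    change (1 : X →ₘ[m] ℝ) x • s.1 x = _
    rw [hx, Pi.one_apply, one_smul]
  mul_smul f g s := by
    induction s using Gamma0.ind with | _ s => ?_
    rw [smul_mk, smul_mk, smul_mk, Gamma0.mk_eq_mk]
    filter_upwards [AEEqFun.coeFn_mul f g] with x hx
    change (f * g : X →ₘ[m] ℝ) x • s.1 x = f x • g x • s.1 x
    rw [hx, Pi.mul_apply, mul_smul]
  add_smul f g s := by
    induction s using Gamma0.ind with | _ s => ?_
    rw [smul_mk, smul_mk, smul_mk, ← map_add, Gamma0.mk_eq_mk]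
    filter_upwards [AEEqFun.coeFn_add f g] with x hx
    change (f + g : X →ₘ[m] ℝ) x • s.1 x = f x • s.1 x + g x • s.1 x
    rw [hx, Pi.add_apply, add_smul]
  zero_smul s := by
    induction s using Gamma0.ind with | _ s => ?_
    rw [smul_mk, ← map_zero (Gamma0.mk (T := T)), Gamma0.mk_eq_mk]
    filter_upwards [AEEqFun.coeFn_zero (μ := m) (α := X) (β := ℝ)] with x hx
    change (0 : X →ₘ[m] ℝ) x • s.1 x = 0
    rw [hx, Pi.zero_apply, zero_smul]

lemma measurable_nrm_section (s : T.sections) : Measurable fun x => T.nrm ⟨x, s.1 x⟩ :=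
  T.measurable_nrm.comp s.2

/-- The pointwise norm `|s|(x) = 𝗇(s(x))` on `Γ₀(T)`. -/
def pnorm0 (s : T.Gamma0) : X →ₘ[m] ℝ :=
  Quotient.liftOn' s
    (fun s => AEEqFun.mk (fun x => T.nrm ⟨x, s.1 x⟩) (measurable_nrm_section s).aestronglyMeasurable)
    (fun s t h => by
      have h' : ∀ᵐ x ∂m, s.1 x = t.1 x := Gamma0.mk_eq_mk.1 (Quotient.sound' h)
      refine AEEqFun.mk_eq_mk.2 ?_
      filter_upwards [h'] with x hx
      rw [hx])

lemma coeFn_pnorm0_mk (s : T.sections) :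
    pnorm0 (Gamma0.mk s) =ᵐ[m] fun x => T.nrm ⟨x, s.1 x⟩ :=
  AEEqFun.coeFn_mk _ _

lemma pnorm0_nonneg (s : T.Gamma0) : 0 ≤ pnorm0 s := by
  induction s using Gamma0.ind with | _ s => ?_
  rw [← AEEqFun.coeFn_le]
  filter_upwards [coeFn_pnorm0_mk s, AEEqFun.coeFn_zero (μ := m) (α := X) (β := ℝ)] with x hx h0
  rw [hx, h0]
  exact T.nrm_nonneg _

lemma pnorm0_smul (f : X →ₘ[m] ℝ) (s : T.Gamma0) : pnorm0 (f • s) = |f| * pnorm0 s := by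
  induction s using Gamma0.ind with | _ s => ?_
  rw [smul_mk]
  refine AEEqFun.ext ?_
  filter_upwards [coeFn_pnorm0_mk s, coeFn_pnorm0_mk (smulSection f f.stronglyMeasurable.measurable s),
    AEEqFun.coeFn_mul |f| (pnorm0 (Gamma0.mk s)), AEEqFun.coeFn_abs f, T.ae_isNormFun]
    with x h1 h2 h3 h4 h5
  rw [h2, h3, Pi.mul_apply, h4, h1]
  exact h5.smul_eq _ _

lemma pnorm0_add_le (s t : T.Gamma0) : pnorm0 (s + t) ≤ pnorm0 s + pnorm0 t := by
  induction s using Gamma0.ind with | _ s => ?_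
  induction t using Gamma0.ind with | _ t => ?_
  rw [← map_add, ← AEEqFun.coeFn_le]
  filter_upwards [coeFn_pnorm0_mk s, coeFn_pnorm0_mk t, coeFn_pnorm0_mk (s + t),
    AEEqFun.coeFn_add (pnorm0 (Gamma0.mk s)) (pnorm0 (Gamma0.mk t)), T.ae_isNormFun]
    with x h1 h2 h3 h4 h5
  rw [h3, h4, Pi.add_apply, h1, h2]
  exact h5.add_le _ _

lemma eq_zero_of_pnorm0_eq_zero (s : T.Gamma0) (hs : pnorm0 s = 0) : s = 0 := by
  induction s using Gamma0.ind with | _ s => ?_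
  rw [← map_zero (Gamma0.mk (T := T)), Gamma0.mk_eq_mk]
  have h0 := AEEqFun.coeFn_zero (μ := m) (α := X) (β := ℝ)
  rw [← hs] at h0
  filter_upwards [coeFn_pnorm0_mk s, h0, T.ae_isNormFun] with x h1 h2 h3
  exact h3.eq_zero _ (h1.symm.trans h2)

lemma pnorm0_zero : pnorm0 (0 : T.Gamma0) = 0 := by
  have h := pnorm0_smul (0 : X →ₘ[m] ℝ) (0 : T.Gamma0)
  have h0 : |(0 : X →ₘ[m] ℝ)| = 0 := by
    refine AEEqFun.ext ?_
    filter_upwards [AEEqFun.coeFn_abs (0 : X →ₘ[m] ℝ),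
      AEEqFun.coeFn_zero (μ := m) (α := X) (β := ℝ)] with x h1 h2
    rw [h1, h2, Pi.zero_apply, abs_zero]
  rwa [zero_smul, h0, zero_mul] at h

lemma pnorm0_neg (s : T.Gamma0) : pnorm0 (-s) = pnorm0 s := by
  have h := pnorm0_smul (-1 : X →ₘ[m] ℝ) s
  rw [neg_smul, one_smul, abs_neg] at h
  have h1 : |(1 : X →ₘ[m] ℝ)| = 1 := by
    refine AEEqFun.ext ?_
    filter_upwards [AEEqFun.coeFn_abs (1 : X →ₘ[m] ℝ), AEEqFun.coeFn_one (μ := m) (β := ℝ)]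
      with x h1 h2
    rw [h1, h2, Pi.one_apply, abs_one]
  rwa [h1, one_mul] at h

/-! ### The `L^p`-sections -/

lemma mem_Lp_of_le {p : ℝ≥0∞} {f g : X →ₘ[m] ℝ} (hf : 0 ≤ f) (hfg : f ≤ g) (hg : g ∈ Lp ℝ p m) :
    f ∈ Lp ℝ p m := by
  refine Lp.mem_Lp_iff_memLp.2 ((Lp.mem_Lp_iff_memLp.1 hg).of_le f.aestronglyMeasurable ?_)
  rw [← AEEqFun.coeFn_le] at hf hfg
  filter_upwards [hf, hfg, AEEqFun.coeFn_zero (μ := m) (α := X) (β := ℝ)] with x h1 h2 h3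
  rw [h3, Pi.zero_apply] at h1
  rw [Real.norm_of_nonneg h1, Real.norm_of_nonneg (h1.trans h2)]
  exact h2

variable (T) (p : ℝ≥0∞)

/-- `Γ_p(T) = {s ∈ Γ₀(T) : |s| ∈ L^p(m)}`, as an `L^∞(m)`-module. -/
def GammaP : Submodule (Linf m) T.Gamma0 where
  carrier := {s | pnorm0 s ∈ Lp ℝ p m}
  zero_mem' := by
    change pnorm0 (0 : T.Gamma0) ∈ Lp ℝ p m
    rw [pnorm0_zero]
    exact (Lp ℝ p m).zero_mem
  add_mem' {s t} hs ht :=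
    mem_Lp_of_le (pnorm0_nonneg _) (pnorm0_add_le s t) ((Lp ℝ p m).add_mem hs ht)
  smul_mem' f s hs := by
    change pnorm0 ((f : X →ₘ[m] ℝ) • s) ∈ Lp ℝ p m
    rw [pnorm0_smul]
    refine Lp.mem_Lp_iff_memLp.2 ?_
    have hf : MemLp (|(f : X →ₘ[m] ℝ)| : X →ₘ[m] ℝ) ∞ m :=
      (memLp_congr_ae (AEEqFun.coeFn_abs (f : X →ₘ[m] ℝ))).2 (Lp.mem_Lp_iff_memLp.1 f.2).abs
    exact (memLp_congr_ae (AEEqFun.coeFn_mul _ _)).2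
      ((Lp.mem_Lp_iff_memLp.1 hs).mul (p := ∞) (q := p) (r := p) hf)

variable {T p}

/-- The pointwise norm on `Γ_p(T)`. -/
def pnormP (s : T.GammaP p) : Lp ℝ p m := ⟨pnorm0 s.1, s.2⟩

lemma pnormP_nonneg (s : T.GammaP p) : 0 ≤ pnormP s := pnorm0_nonneg s.1

variable [Fact (1 ≤ p)]

/-- The norm `‖s‖ = ‖ |s| ‖_{L^p}` on `Γ_p(T)`. -/
instance : NormedAddCommGroup (T.GammaP p) :=
  AddGroupNorm.toNormedAddCommGroup
    { toFun := fun s => ‖pnormP s‖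
      map_zero' := by
        have h : pnormP (0 : T.GammaP p) = 0 := Subtype.ext pnorm0_zero
        rw [h, norm_zero]
      add_le' := fun s t => by
        refine le_trans ?_ (norm_add_le (pnormP s) (pnormP t))
        refine norm_le_norm_of_abs_le_abs ?_
        rw [abs_of_nonneg (pnormP_nonneg _),
          abs_of_nonneg (add_nonneg (pnormP_nonneg s) (pnormP_nonneg t))]
        exact pnorm0_add_le s.1 t.1
      neg' := fun s => congrArg norm (Subtype.ext (pnorm0_neg s.1))
      eq_zero_of_map_eq_zero' := fun s hs =>
        Subtype.ext (eq_zero_of_pnorm0_eq_zero s.1 (congrArg Subtype.val (norm_eq_zero.1 hs))) }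

lemma norm_eq_norm_pnormP (s : T.GammaP p) : ‖s‖ = ‖pnormP s‖ := rfl

variable (T p)

/-- `Γ_p(T)` with its module structure, its norm and its pointwise norm. -/
def gammaObj : PreNMod m p where
  carrier := T.GammaP p
  pnorm := pnormP
  pnorm_nonneg := pnormP_nonneg
  pnorm_smul f s := pnorm0_smul (f : X →ₘ[m] ℝ) s.1
  norm_eq := norm_eq_norm_pnormP

/-! ### The action on morphisms -/

variable {T} {T₁ T₂ T₃ : MBB m}

/-- `φ ∘ s`, for a pre-morphism `φ` and a section `s`. -/
def PreHom.onSection (φ : PreHom T₁ T₂) (s : T₁.sections) : T₂.sections :=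
  ⟨fun x => φ.app x (s.1 x), φ.measurable.comp s.2⟩

/-- `Γ₀(φ)`, sending the class of `s` to the class of `φ ∘ s`. -/
def gammaMap0 (φ : T₁ ⟶ T₂) (s : T₁.Gamma0) : T₂.Gamma0 :=
  Quotient.liftOn₂' φ s (fun φ s => Gamma0.mk (φ.onSection s)) (by
    intro φ s ψ t h h'
    have h' : ∀ᵐ x ∂m, s.1 x = t.1 x := Gamma0.mk_eq_mk.1 (Quotient.sound' h')
    refine Gamma0.mk_eq_mk.2 ?_
    filter_upwards [h, h'] with x hx hy
    change φ.app x (s.1 x) = ψ.app x (t.1 x)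
    rw [hx, hy])

lemma gammaMap0_mk (φ : PreHom T₁ T₂) (s : T₁.sections) :
    gammaMap0 (⟦φ⟧ : T₁ ⟶ T₂) (Gamma0.mk s) = Gamma0.mk (φ.onSection s) := rfl

lemma gammaMap0_add (φ : T₁ ⟶ T₂) (s t : T₁.Gamma0) :
    gammaMap0 φ (s + t) = gammaMap0 φ s + gammaMap0 φ t := by
  induction φ using Quotient.inductionOn with | _ φ => ?_
  induction s using Gamma0.ind with | _ s => ?_
  induction t using Gamma0.ind with | _ t => ?_
  rw [← map_add, gammaMap0_mk, gammaMap0_mk, gammaMap0_mk, ← map_add, Gamma0.mk_eq_mk]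
  filter_upwards [φ.ae_linear] with x hx
  exact hx.map_add _ _

lemma gammaMap0_smul (φ : T₁ ⟶ T₂) (f : X →ₘ[m] ℝ) (s : T₁.Gamma0) :
    gammaMap0 φ (f • s) = f • gammaMap0 φ s := by
  induction φ using Quotient.inductionOn with | _ φ => ?_
  induction s using Gamma0.ind with | _ s => ?_
  rw [smul_mk, gammaMap0_mk, gammaMap0_mk, smul_mk, Gamma0.mk_eq_mk]
  filter_upwards [φ.ae_linear] with x hx
  exact hx.map_smul _ _

lemma pnorm0_gammaMap0_le (φ : T₁ ⟶ T₂) (s : T₁.Gamma0) : pnorm0 (gammaMap0 φ s) ≤ pnorm0 s := by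
  induction φ using Quotient.inductionOn with | _ φ => ?_
  induction s using Gamma0.ind with | _ s => ?_
  rw [gammaMap0_mk, ← AEEqFun.coeFn_le]
  filter_upwards [coeFn_pnorm0_mk s, coeFn_pnorm0_mk (φ.onSection s), φ.ae_linear, φ.ae_lipschitz]
    with x h1 h2 h3 h4
  rw [h1, h2]
  have h := h4 (s.1 x) 0
  rwa [h3.map_zero, sub_zero, sub_zero] at h

/-- `Γ_p(φ)`: the restriction of `Γ₀(φ)` to `Γ_p(T₁)`. -/
def gammaMap (φ : T₁ ⟶ T₂) : gammaObj T₁ p ⟶ gammaObj T₂ p where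
  toLinearMap :=
    { toFun := fun s => (⟨gammaMap0 φ s.1,
        mem_Lp_of_le (pnorm0_nonneg _) (pnorm0_gammaMap0_le φ s.1) s.2⟩ : T₂.GammaP p)
      map_add' := fun s t => Subtype.ext (gammaMap0_add φ s.1 t.1)
      map_smul' := fun f s => Subtype.ext (gammaMap0_smul φ (f : X →ₘ[m] ℝ) s.1) }
  pnorm_le s := pnorm0_gammaMap0_le φ s.1

end MBB

open MBB in
/-- The `L^p`-section functor `T ↦ Γ_p(T)`, `φ ↦ Γ_p(φ)`. -/
def sectionFunctor (m : Measure X) (p : ℝ≥0∞) [Fact (1 ≤ p)] : MBB m ⥤ PreNMod m p where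
  obj T := gammaObj T p
  map φ := gammaMap p φ
  map_id T := by
    refine PreNMod.Hom.ext (LinearMap.ext fun s => Subtype.ext ?_)
    obtain ⟨s, hs⟩ := s
    induction s using Gamma0.ind
    rfl
  map_comp φ ψ := by
    refine PreNMod.Hom.ext (LinearMap.ext fun s => Subtype.ext ?_)
    obtain ⟨s, hs⟩ := s
    induction s using Gamma0.ind
    induction φ using Quotient.inductionOn
    induction ψ using Quotient.inductionOn
    rfl

end NormedModules

end

/-!
The section functor is shown to be fully faithful and essentially surjective.

*Section modules.* Locality holds in every module with a pointwise norm. Glueing is Fatou's lemma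
applied to the partial sums, and completeness is the Riesz–Fischer argument: an absolutely
convergent series of sections converges in a.e. fibre because the fibres are finite-dimensional
(`completeSpace_gammaObj`). The coordinate sections, multiplied by a positive function making them
`p`-integrable (`exists_frame`), form a local basis, so the section module is proper.

*Full faithfulness.* A morphism of section modules commutes with `L^∞`-combinations of the frame,
hence acts pointwise by the matrix given by the images of the frame (`ev_map_eq_sum`). The
contraction property on a.e. fibre follows from the one for the countably many rational combinations
of the frame.

*Essential surjectivity.* Let `v₁, …, vₙ` be a local basis of a proper module on a set `E`. The
triangle inequality holds pointwise (`ae_add_le`), so for a.e. `x` the map `q ↦ |∑ qᵢ vᵢ|(x)` is a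
seminorm on `ℚⁿ`. Its extension to `ℝⁿ` is jointly measurable (`measurable_ratExtend`) and computes
`|∑ fᵢ vᵢ|` for all `fᵢ ∈ L^∞` (`ae_pnorm_sum_smul`). It is a norm for a.e. `x ∈ E`: otherwise a
measurable selection of kernel vectors (`exists_measurable_kernel_vector`) would be a linear
relation among the `vᵢ` (`IndependentOn.ae_fiberNorm_eq_zero`). This gives a bundle. A section `s`
of it is said to represent `w` when `|w - ∑ qᵢ vᵢ|(x) ≤ |s(x) - q|` for all rational `q` and a.e.
`x`. This relation is linear and preserves pointwise norms; every `w` is represented because the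
basis spans, and every `L^p`-section represents some `w` by glueing (`exists_represents`). Hence it
is the graph of an isomorphism between the section module and the given one.
-/

noncomputable section

namespace NormedModules

open Filter Topology

variable {X : Type u} [MeasurableSpace X]

/-! ### Seminorms on `ℝⁿ` -/

/-- `g` is a seminorm on the real vector space `V`. -/
structure IsSeminormFun {V : Type*} [AddCommGroup V] [Module ℝ V] (g : V → ℝ) : Prop where
  add_le : ∀ v w, g (v + w) ≤ g v + g w
  smul_eq : ∀ (c : ℝ) v, g (c • v) = |c| * g v

namespace IsSeminormFun

section

variable {V : Type*} [AddCommGroup V] [Module ℝ V] {g : V → ℝ}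

lemma map_zero (hg : IsSeminormFun g) : g 0 = 0 := by
  simpa using hg.smul_eq 0 0

lemma map_neg (hg : IsSeminormFun g) (v : V) : g (-v) = g v := by
  simpa using hg.smul_eq (-1) v

lemma nonneg (hg : IsSeminormFun g) (v : V) : 0 ≤ g v := by
  have h := hg.add_le v (-v)
  rw [add_neg_cancel, hg.map_zero, hg.map_neg] at h
  linarith

lemma le_add_sub (hg : IsSeminormFun g) (v w : V) : g v ≤ g w + g (v - w) := by
  simpa using hg.add_le w (v - w)

lemma map_sub_rev (hg : IsSeminormFun g) (v w : V) : g (v - w) = g (w - v) := by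
  rw [← hg.map_neg, neg_sub]

lemma sum_le (hg : IsSeminormFun g) {ι : Type*} (s : Finset ι) (v : ι → V) :
    g (∑ i ∈ s, v i) ≤ ∑ i ∈ s, g (v i) := by
  classical
  induction s using Finset.induction_on with
  | empty => simp [hg.map_zero]
  | insert a s ha ih =>
    rw [Finset.sum_insert ha, Finset.sum_insert ha]
    exact (hg.add_le _ _).trans (by gcongr)

lemma comp_linearMap (hg : IsSeminormFun g) {W : Type*} [AddCommGroup W] [Module ℝ W]
    (L : W →ₗ[ℝ] V) : IsSeminormFun fun w => g (L w) where
  add_le v w := by rw [map_add]; exact hg.add_le _ _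
  smul_eq c v := by rw [map_smul]; exact hg.smul_eq _ _

end

variable {n : ℕ} {g : (Fin n → ℝ) → ℝ}

lemma le_sum_single (hg : IsSeminormFun g) (v : Fin n → ℝ) :
    g v ≤ ∑ i, |v i| * g (Pi.single i 1) := by
  have hv : v = ∑ i, v i • (Pi.single i 1 : Fin n → ℝ) := by
    conv_lhs => rw [← Finset.univ_sum_single v]
    refine Finset.sum_congr rfl fun i _ => ?_
    rw [← Pi.single_smul, smul_eq_mul, mul_one]
  conv_lhs => rw [hv]
  exact (hg.sum_le _ _).trans (by simp only [hg.smul_eq]; rfl)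

lemma continuous (hg : IsSeminormFun g) : Continuous g := by
  rw [continuous_iff_continuousAt]
  intro v
  have hlim : Tendsto (fun w : Fin n → ℝ => ∑ i, |w i - v i| * g (Pi.single i 1)) (𝓝 v) (𝓝 0) := by
    have hc : Continuous fun w : Fin n → ℝ => ∑ i, |w i - v i| * g (Pi.single i 1) := by fun_prop
    simpa using hc.tendsto v
  refine tendsto_iff_dist_tendsto_zero.2 (squeeze_zero (fun _ => dist_nonneg) (fun w => ?_) hlim)
  refine le_trans ?_ (hg.le_sum_single (w - v))
  rw [Real.dist_eq, abs_le]
  constructor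
  · linarith [hg.le_add_sub v w, hg.map_sub_rev v w]
  · linarith [hg.le_add_sub w v]

/-- A norm on `ℝⁿ` dominates the supremum norm. -/
lemma exists_norm_le_mul (hg : IsSeminormFun g) (h0 : ∀ v, g v = 0 → v = 0) :
    ∃ C : ℝ, 0 < C ∧ ∀ v, ‖v‖ ≤ C * g v := by
  rcases (Metric.sphere (0 : Fin n → ℝ) 1).eq_empty_or_nonempty with he | hne
  · refine ⟨1, one_pos, fun v => ?_⟩
    by_cases hv : v = 0
    · simp [hv, hg.map_zero]
    · have : ‖v‖⁻¹ • v ∈ Metric.sphere (0 : Fin n → ℝ) 1 := by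
        simp [norm_smul, norm_ne_zero_iff.2 hv]
      rw [he] at this
      exact this.elim
  · obtain ⟨u, hu, hmin⟩ := (isCompact_sphere (0 : Fin n → ℝ) 1).exists_isMinOn hne
      hg.continuous.continuousOn
    have hu0 : u ≠ 0 := by rintro rfl; simp at hu
    have hpos : 0 < g u := lt_of_le_of_ne (hg.nonneg u) fun h => hu0 (h0 u h.symm)
    refine ⟨(g u)⁻¹, inv_pos.2 hpos, fun v => ?_⟩
    by_cases hv : v = 0
    · simp [hv, hg.map_zero]
    have hvn : 0 < ‖v‖ := norm_pos_iff.2 hv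
    have : ‖v‖⁻¹ • v ∈ Metric.sphere (0 : Fin n → ℝ) 1 := by
      simp [norm_smul, norm_ne_zero_iff.2 hv]
    have h := hmin this
    simp only [Set.mem_ofPred_eq, hg.smul_eq, abs_inv, abs_norm] at h
    rw [inv_mul_eq_div, le_div_iff₀ hpos]
    rw [inv_mul_eq_div, le_div_iff₀ hvn] at h
    linarith

end IsSeminormFun

lemma IsNormFun.isSeminormFun {V : Type*} [AddCommGroup V] [Module ℝ V] {g : V → ℝ}
    (hg : IsNormFun g) : IsSeminormFun g := ⟨hg.add_le, hg.smul_eq⟩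

lemma denseRange_ratCast_pi (n : ℕ) :
    DenseRange fun (q : Fin n → ℚ) (i : Fin n) => (q i : ℝ) :=
  DenseRange.piMap fun _ => Rat.denseRange_cast

/-- A lower bound for a continuous function on `ℝⁿ` may be tested on rational vectors. -/
lemma le_of_forall_rat {n : ℕ} {F : (Fin n → ℝ) → ℝ} (hF : Continuous F) {a : ℝ}
    (h : ∀ q : Fin n → ℚ, a ≤ F fun i => (q i : ℝ)) (c : Fin n → ℝ) : a ≤ F c :=
  (denseRange_ratCast_pi n).induction_on (p := fun c => a ≤ F c) c
    (isClosed_le continuous_const hF) h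

/-- The extension to `ℝⁿ` of a seminorm `g` on the rational vector space `ℚⁿ`, written as an
infimum over a countable set so that it depends measurably on `g`. -/
def ratExtend {n : ℕ} (g : (Fin n → ℚ) → ℝ) (c : Fin n → ℝ) : ℝ :=
  ⨅ q : Fin n → ℚ, (|g q| + ∑ i, |c i - q i| * |g (Pi.single i 1)|)

section ratExtend

variable {n : ℕ} {g : (Fin n → ℚ) → ℝ}

lemma ratExtend_bddBelow (g : (Fin n → ℚ) → ℝ) (c : Fin n → ℝ) :
    BddBelow (Set.range fun q : Fin n → ℚ =>
      (|g q| + ∑ i, |c i - q i| * |g (Pi.single i 1)|)) :=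
  ⟨0, by rintro _ ⟨q, rfl⟩; positivity⟩

lemma ratExtend_nonneg (g : (Fin n → ℚ) → ℝ) (c : Fin n → ℝ) : 0 ≤ ratExtend g c :=
  Real.iInf_nonneg fun q => by positivity

lemma ratExtend_le_add (g : (Fin n → ℚ) → ℝ) (c d : Fin n → ℝ) :
    ratExtend g c ≤ ratExtend g d + ∑ i, |c i - d i| * |g (Pi.single i 1)| := by
  rw [← sub_le_iff_le_add]
  refine le_ciInf fun q => ?_
  rw [sub_le_iff_le_add]
  refine (ciInf_le (ratExtend_bddBelow g c) q).trans ?_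
  rw [add_assoc, ← Finset.sum_add_distrib]
  gcongr with i
  rw [← add_mul]
  gcongr
  rw [add_comm]
  exact abs_sub_le _ _ _

lemma continuous_ratExtend (g : (Fin n → ℚ) → ℝ) : Continuous (ratExtend g) := by
  rw [continuous_iff_continuousAt]
  intro v
  have hlim : Tendsto (fun w : Fin n → ℝ => ∑ i, |w i - v i| * |g (Pi.single i 1)|)
      (𝓝 v) (𝓝 0) := by
    have hc : Continuous fun w : Fin n → ℝ => ∑ i, |w i - v i| * |g (Pi.single i 1)| := by fun_prop
    simpa using hc.tendsto v
  refine tendsto_iff_dist_tendsto_zero.2 (squeeze_zero (fun _ => dist_nonneg) (fun w => ?_) hlim)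
  rw [Real.dist_eq, abs_le]
  have h1 := ratExtend_le_add g v w
  simp only [abs_sub_comm (v _)] at h1
  constructor <;> linarith [ratExtend_le_add g w v]

/-- The seminorm axioms on `ℚⁿ`. -/
structure IsRatSeminorm (g : (Fin n → ℚ) → ℝ) : Prop where
  add_le : ∀ q r, g (q + r) ≤ g q + g r
  smul_eq : ∀ (a : ℚ) q, g (a • q) = |(a : ℝ)| * g q

namespace IsRatSeminorm

lemma map_zero (hg : IsRatSeminorm g) : g 0 = 0 := by simpa using hg.smul_eq 0 0

lemma nonneg (hg : IsRatSeminorm g) (q : Fin n → ℚ) : 0 ≤ g q := by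
  have h := hg.add_le q ((-1 : ℚ) • q)
  have h1 := hg.smul_eq (-1) q
  rw [h1] at h
  simp [hg.map_zero] at h
  exact h

lemma le_sum (hg : IsRatSeminorm g) (q : Fin n → ℚ) :
    g q ≤ ∑ i, |(q i : ℝ)| * g (Pi.single i 1) := by
  have hv : q = ∑ i, q i • (Pi.single i 1 : Fin n → ℚ) := by
    conv_lhs => rw [← Finset.univ_sum_single q]
    refine Finset.sum_congr rfl fun i _ => ?_
    rw [← Pi.single_smul, smul_eq_mul, mul_one]
  have key : ∀ s : Finset (Fin n), g (∑ i ∈ s, q i • (Pi.single i 1 : Fin n → ℚ)) ≤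
      ∑ i ∈ s, |(q i : ℝ)| * g (Pi.single i 1) := by
    intro s
    induction s using Finset.induction_on with
    | empty => simp [hg.map_zero]
    | insert a s ha ih =>
      rw [Finset.sum_insert ha, Finset.sum_insert ha, ← hg.smul_eq]
      exact (hg.add_le _ _).trans (by gcongr)
  conv_lhs => rw [hv]
  exact key _

lemma ratExtend_eq (hg : IsRatSeminorm g) (q : Fin n → ℚ) :
    ratExtend g (fun i => (q i : ℝ)) = g q := by
  apply le_antisymm
  · refine (ciInf_le (ratExtend_bddBelow g _) q).trans ?_
    simp [abs_of_nonneg (hg.nonneg _)]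
  · refine le_ciInf fun r => ?_
    have h1 := hg.add_le r (q - r)
    have h2 := hg.le_sum (q - r)
    rw [add_sub_cancel] at h1
    simp only [abs_of_nonneg (hg.nonneg _)]
    simp only [Pi.sub_apply, Rat.cast_sub] at h2
    linarith

lemma isSeminormFun_ratExtend (hg : IsRatSeminorm g) : IsSeminormFun (ratExtend g) where
  add_le v w := by
    have hc := continuous_ratExtend g
    refine (denseRange_ratCast_pi n).induction_on₂ (p := fun v w =>
      ratExtend g (v + w) ≤ ratExtend g v + ratExtend g w) ?_ (fun q r => ?_) v w
    · exact isClosed_le (by fun_prop) (by fun_prop)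
    · have := hg.ratExtend_eq (q + r)
      simp only [Pi.add_apply, Rat.cast_add] at this
      change ratExtend g (fun i => (q i : ℝ) + (r i : ℝ)) ≤ _
      rw [this, hg.ratExtend_eq, hg.ratExtend_eq]
      exact hg.add_le q r
  smul_eq c v := by
    have hc := continuous_ratExtend g
    refine (Rat.denseRange_cast (𝕜 := ℝ)).induction_on (p := fun c : ℝ =>
      ratExtend g (c • v) = |c| * ratExtend g v) c ?_ fun a => ?_
    · exact isClosed_eq (by fun_prop) (by fun_prop)
    refine (denseRange_ratCast_pi n).induction_on (p := fun v =>
      ratExtend g ((a : ℝ) • v) = |(a : ℝ)| * ratExtend g v) v ?_ fun q => ?_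
    · exact isClosed_eq (by fun_prop) (by fun_prop)
    · have := hg.ratExtend_eq (a • q)
      simp only [Pi.smul_apply, smul_eq_mul, Rat.cast_mul] at this
      change ratExtend g (fun i => (a : ℝ) * (q i : ℝ)) = _
      rw [this, hg.ratExtend_eq]
      exact hg.smul_eq a q

end IsRatSeminorm

lemma measurable_ratExtend {Y : Type*} [MeasurableSpace Y] {G : Y → (Fin n → ℚ) → ℝ}
    {c : Y → Fin n → ℝ} (hG : ∀ q, Measurable fun y => G y q) (hc : Measurable c) :
    Measurable fun y => ratExtend (G y) (c y) := by
  unfold ratExtend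
  refine Measurable.iInf fun q => ?_
  have h := fun i => hG (Pi.single i 1)
  have h' := hG q
  fun_prop

end ratExtend

/-! ### Measurable selections -/

section selection

variable {Y : Type*} [MeasurableSpace Y]

/-- A countable family of measurable functions may be evaluated along a measurable index. -/
lemma measurable_apply_index {β ι : Type*} [MeasurableSpace β] [Countable ι] [MeasurableSpace ι]
    [MeasurableSingletonClass ι] {F : ι → Y → β} {k : Y → ι} (hF : ∀ j, Measurable (F j))
    (hk : Measurable k) : Measurable fun y => F (k y) y :=
  (measurable_from_prod_countable_right (f := fun z : ι × Y => F z.1 z.2) hF).comp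
    (hk.prodMk measurable_id)

/-- A measurable choice of an index `k` with `y ∈ B k`. -/
lemma exists_measurable_index (B : ℕ → Set Y) (hB : ∀ k, MeasurableSet (B k)) :
    ∃ k : Y → ℕ, Measurable k ∧ ∀ y j, y ∈ B j → y ∈ B (k y) := by
  classical
  set P : Y → ℕ → Prop := fun y j => y ∈ B j ∨ ∀ i, y ∉ B i with hP
  have hex : ∀ y, ∃ j, P y j := fun y => by
    by_cases h : ∃ i, y ∈ B i
    · exact h.imp fun _ => Or.inl
    · exact ⟨0, Or.inr (not_exists.1 h)⟩
  refine ⟨fun y => Nat.find (hex y), measurable_find hex fun j => ?_, fun y j hj => ?_⟩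
  · have : {y | P y j} = B j ∪ ⋂ i, (B i)ᶜ := by
      ext y; simp [hP]
    rw [this]
    exact (hB j).union (MeasurableSet.iInter fun i => (hB i).compl)
  · exact (Nat.find_spec (hex y)).resolve_right fun h => h j hj

/-- A measurable choice of an element with `y ∈ B q`, from a countable index type. -/
lemma exists_measurable_choice {ι : Type*} [Countable ι] [Nonempty ι] [MeasurableSpace ι]
    [MeasurableSingletonClass ι] (B : ι → Set Y) (hB : ∀ q, MeasurableSet (B q)) :
    ∃ k : Y → ι, Measurable k ∧ ∀ y q, y ∈ B q → y ∈ B (k y) := by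
  obtain ⟨e, he⟩ := exists_surjective_nat ι
  obtain ⟨k, hk, hk'⟩ := exists_measurable_index (fun j => B (e j)) fun j => hB _
  refine ⟨fun y => e (k y), measurable_from_nat.comp hk, fun y q hq => ?_⟩
  obtain ⟨j, rfl⟩ := he q
  exact hk' y j hq

/-- A measurable field of seminorms on `ℝⁿ` has a measurable field of kernel vectors, nonzero
wherever the seminorm is not a norm. In the inductive step, where the restriction to the
hyperplane `{0} × ℝⁿ` is a norm but the seminorm is degenerate, there is exactly one kernel vector
of the form `(1, c)`, and it is the limit of any measurable sequence of rational approximations. -/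
lemma exists_measurable_kernel_vector (n : ℕ) (N : Y → (Fin n → ℝ) → ℝ)
    (hN : ∀ c, Measurable fun y => N y c) (hsemi : ∀ y, IsSeminormFun (N y)) :
    ∃ c : Y → Fin n → ℝ, Measurable c ∧ ∀ y, N y (c y) = 0 ∧
      (c y = 0 → ∀ v, N y v = 0 → v = 0) := by
  classical
  induction n with
  | zero =>
    exact ⟨fun _ => 0, measurable_const, fun y => ⟨(hsemi y).map_zero,
      fun _ v _ => Subsingleton.elim _ _⟩⟩
  | succ n ih =>
    -- the inclusion of the hyperplane
    let L : (Fin n → ℝ) →ₗ[ℝ] (Fin (n + 1) → ℝ) :=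
      { toFun := fun v => Fin.cons 0 v
        map_add' := fun v w => by
          funext i; refine Fin.cases ?_ (fun j => ?_) i <;> simp
        map_smul' := fun a v => by
          funext i; refine Fin.cases ?_ (fun j => ?_) i <;> simp }
    have hL : ∀ v, L v = Fin.cons 0 v := fun _ => rfl
    obtain ⟨c', hc', hk'⟩ := ih (fun y v => N y (L v)) (fun c => hN _)
      (fun y => (hsemi y).comp_linearMap L)
    let ι := Fin n → ℚ
    let r : ι → Fin n → ℝ := fun q i => (q i : ℝ)
    let e : (Fin n → ℝ) → Fin (n + 1) → ℝ := fun v => Fin.cons 1 v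
    have hce : Continuous e := by
      refine continuous_pi fun i => ?_
      refine Fin.cases ?_ (fun j => ?_) i
      · simpa [e] using continuous_const
      · simpa [e] using continuous_apply j
    have hdiff : ∀ v w, e v - e w = L (v - w) := fun v w => by
      funext i; refine Fin.cases ?_ (fun j => ?_) i <;> simp [e, hL]
    let B : ℕ → ι → Set Y := fun k q => {y | N y (e (r q)) < 1 / ((k : ℝ) + 1)}
    have hB : ∀ k q, MeasurableSet (B k q) := fun k q => measurableSet_lt (hN _) measurable_const
    have hch := fun k => exists_measurable_choice (B k) (hB k)
    choose Q hQ hQ' using hch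
    -- where the hyperplane carries a norm and the whole space does not
    let D : Set Y := {y | c' y = 0}
    have hD : MeasurableSet D := hc' (measurableSet_singleton 0)
    let G : Set Y := ⋂ k, ⋃ q, B k q
    have hG : MeasurableSet G := MeasurableSet.iInter fun k => MeasurableSet.iUnion (hB k)
    have hQG : ∀ y ∈ G, ∀ k, N y (e (r (Q k y))) < 1 / ((k : ℝ) + 1) := fun y hy k => by
      obtain ⟨q, hq⟩ := Set.mem_iUnion.1 (Set.mem_iInter.1 hy k)
      exact hQ' k y q hq
    have hlim : ∀ y, ∃ l, Tendsto (fun k => if y ∈ D ∩ G then r (Q k y) else 0) atTop (𝓝 l) := by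
      intro y
      by_cases hy : y ∈ D ∩ G
      swap
      · simp only [hy, if_false]; exact ⟨0, tendsto_const_nhds⟩
      simp only [hy, if_true]
      refine cauchySeq_tendsto_of_complete ?_
      obtain ⟨C, hC, hCv⟩ := ((hsemi y).comp_linearMap L).exists_norm_le_mul ((hk' y).2 hy.1)
      refine cauchySeq_of_le_tendsto_0 (fun k : ℕ => C * (1 / ((k : ℝ) + 1) + 1 / ((k : ℝ) + 1)))
        (fun k l N hk hl => ?_) ?_
      · rw [dist_eq_norm]
        refine (hCv _).trans ?_
        rw [← hdiff]
        have h1 := hQG y hy.2 k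
        have h2 := hQG y hy.2 l
        have h3 : 1 / ((k : ℝ) + 1) ≤ 1 / ((N : ℝ) + 1) := by gcongr
        have h4 : 1 / ((l : ℝ) + 1) ≤ 1 / ((N : ℝ) + 1) := by gcongr
        have h5 := (hsemi y).add_le (e (r (Q k y))) (-(e (r (Q l y))))
        rw [(hsemi y).map_neg, ← sub_eq_add_neg] at h5
        gcongr
        linarith
      · have := (tendsto_one_div_add_atTop_nhds_zero_nat (𝕜 := ℝ))
        simpa using (this.add this).const_mul C
    choose l hl using hlim
    have hlm : Measurable l := by
      refine measurable_of_tendsto_metrizable (f := fun k y => if y ∈ D ∩ G then r (Q k y) else 0)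
        (fun k => ?_) (tendsto_pi_nhds.2 hl)
      exact Measurable.ite (hD.inter hG) ((measurable_of_countable r).comp (hQ k)) measurable_const
    refine ⟨fun y => if y ∈ D then (if y ∈ G then e (l y) else 0) else L (c' y), ?_, fun y => ?_⟩
    · refine Measurable.ite hD (Measurable.ite hG (hce.measurable.comp hlm) measurable_const) ?_
      exact L.continuous_of_finiteDimensional.measurable.comp hc'
    by_cases hyD : y ∈ D
    swap
    · simp only [hyD, if_false]
      refine ⟨(hk' y).1, fun h => (hyD ?_).elim⟩
      change c' y = 0
      funext i
      have := congrFun h i.succ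
      simpa [hL] using this
    by_cases hyG : y ∈ G
    · simp only [hyD, hyG, if_true]
      refine ⟨?_, fun h => ?_⟩
      · have h1 := hl y
        simp only [Set.mem_inter_iff, hyD, hyG, and_self, if_true] at h1
        have h2 := ((hsemi y).continuous.comp hce).tendsto (l y) |>.comp h1
        refine le_antisymm ?_ ((hsemi y).nonneg _)
        exact le_of_tendsto_of_tendsto' h2 (tendsto_one_div_add_atTop_nhds_zero_nat (𝕜 := ℝ))
          fun k => (hQG y hyG k).le
      · have := congrFun h 0
        simp [e] at this
    · simp only [hyD, hyG, if_true, if_false]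
      refine ⟨(hsemi y).map_zero, fun _ v hv => ?_⟩
      have hv0 : v 0 = 0 := by
        by_contra hne
        apply hyG
        refine Set.mem_iInter.2 fun k => ?_
        set w : Fin n → ℝ := fun i => (v 0)⁻¹ * v i.succ with hw
        have hew : e w = (v 0)⁻¹ • v := by
          funext i; refine Fin.cases ?_ (fun j => ?_) i <;> simp [e, hw, hne]
        have hNw : N y (e w) = 0 := by rw [hew, (hsemi y).smul_eq, hv, mul_zero]
        have hopen : IsOpen {u | N y (e u) < 1 / ((k : ℝ) + 1)} :=
          isOpen_lt ((hsemi y).continuous.comp hce) continuous_const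
        obtain ⟨q, hq⟩ := (denseRange_ratCast_pi n).exists_mem_open hopen
          ⟨w, by simp only [Set.mem_ofPred_eq, hNw]; positivity⟩
        exact Set.mem_iUnion.2 ⟨q, hq⟩
      have hvL : v = L fun i => v i.succ := by
        funext i; refine Fin.cases ?_ (fun j => ?_) i <;> simp [hL, hv0]
      rw [hvL] at hv ⊢
      rw [(hk' y).2 hyD _ hv, map_zero]

end selection

/-! ### Bounded functions as elements of `L^∞` -/

section Linf

variable {m : Measure X}

/-- The class in `L^∞(m)` of a bounded measurable function. -/
def Linf.ofBounded (m : Measure X) (f : X → ℝ) (hf : Measurable f) (hb : ∃ C, ∀ x, |f x| ≤ C) :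
    Linf m :=
  ⟨AEEqFun.mk f hf.aestronglyMeasurable,
    Lp.mem_Lp_iff_memLp.2 ((memLp_congr_ae (AEEqFun.coeFn_mk _ _)).2
      (memLp_top_of_bound hf.aestronglyMeasurable hb.choose (.of_forall hb.choose_spec)))⟩

lemma Linf.coeFn_ofBounded {f : X → ℝ} (hf : Measurable f) (hb : ∃ C, ∀ x, |f x| ≤ C) :
    (Linf.ofBounded m f hf hb).1 =ᵐ[m] f :=
  AEEqFun.coeFn_mk _ _

/-- The class of a constant function. -/
def Linf.const (m : Measure X) (c : ℝ) : Linf m :=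
  Linf.ofBounded m (fun _ => c) measurable_const ⟨|c|, fun _ => le_rfl⟩

lemma Linf.coeFn_const (c : ℝ) : ∀ᵐ x ∂m, (Linf.const m c).1 x = c :=
  Linf.coeFn_ofBounded _ _

lemma Linf.ext_ae {f g : Linf m} (h : ∀ᵐ x ∂m, f.1 x = g.1 x) : f = g :=
  Subtype.ext (AEEqFun.ext h)

lemma Linf.const_add (a b : ℝ) : Linf.const m (a + b) = Linf.const m a + Linf.const m b := by
  refine Linf.ext_ae ?_
  filter_upwards [Linf.coeFn_const (m := m) a, Linf.coeFn_const (m := m) b,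
    Linf.coeFn_const (m := m) (a + b),
    AEEqFun.coeFn_add (Linf.const m a).1 (Linf.const m b).1] with x h1 h2 h3 h4
  rw [h3]
  exact ((h4.trans (by rw [Pi.add_apply, h1, h2]))).symm

lemma Linf.const_mul (a b : ℝ) : Linf.const m (a * b) = Linf.const m a * Linf.const m b := by
  refine Linf.ext_ae ?_
  filter_upwards [Linf.coeFn_const (m := m) a, Linf.coeFn_const (m := m) b,
    Linf.coeFn_const (m := m) (a * b),
    AEEqFun.coeFn_mul (Linf.const m a).1 (Linf.const m b).1] with x h1 h2 h3 h4
  rw [h3]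
  exact ((h4.trans (by rw [Pi.mul_apply, h1, h2]))).symm

lemma Linf.coeFn_sub (f g : Linf m) : ∀ᵐ x ∂m, (f - g).1 x = f.1 x - g.1 x :=
  AEEqFun.coeFn_sub f.1 g.1

lemma Linf.coeFn_mul (f g : Linf m) : ∀ᵐ x ∂m, (f * g).1 x = f.1 x * g.1 x :=
  AEEqFun.coeFn_mul f.1 g.1

lemma Linf.coeFn_zero : ∀ᵐ x ∂m, (0 : Linf m).1 x = 0 :=
  AEEqFun.coeFn_zero (μ := m) (α := X) (β := ℝ)

lemma Linf.measurable (f : Linf m) : Measurable fun x => f.1 x := f.1.stronglyMeasurable.measurable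

lemma coeFn_chi {A : Set X} (hA : MeasurableSet A) :
    ∀ᵐ x ∂m, (chi m hA).1 x = A.indicator (fun _ => (1 : ℝ)) x :=
  AEEqFun.coeFn_mk _ _

end Linf

/-! ### Pointwise calculus in normed modules -/

namespace PreNMod

variable {m : Measure X} {p : ℝ≥0∞} [Fact (1 ≤ p)] (M : PreNMod m p)

lemma measurable_pnorm (v : M) : Measurable fun x => M.pnorm v x :=
  (Lp.stronglyMeasurable (M.pnorm v)).measurable

lemma ae_nonneg (v : M) : ∀ᵐ x ∂m, 0 ≤ M.pnorm v x :=
  (Lp.coeFn_nonneg _).2 (M.pnorm_nonneg v)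

lemma ae_smul (f : Linf m) (v : M) : ∀ᵐ x ∂m, M.pnorm (f • v) x = |f.1 x| * M.pnorm v x := by
  have h := M.pnorm_smul f v
  filter_upwards [AEEqFun.coeFn_mul |f.1| (M.pnorm v).1, AEEqFun.coeFn_abs f.1] with x h1 h2
  rw [← h2]
  exact (congrArg (fun g : X →ₘ[m] ℝ => g x) h).trans h1

lemma ae_const_smul (c : ℝ) (v : M) :
    ∀ᵐ x ∂m, M.pnorm (Linf.const m c • v) x = |c| * M.pnorm v x := by
  filter_upwards [M.ae_smul (Linf.const m c) v, Linf.coeFn_const (m := m) c] with x h1 h2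
  rw [h1, h2]

lemma ae_chi_smul {A : Set X} (hA : MeasurableSet A) (v : M) :
    ∀ᵐ x ∂m, M.pnorm (chi m hA • v) x = A.indicator (fun x => M.pnorm v x) x := by
  filter_upwards [M.ae_smul (chi m hA) v, coeFn_chi (m := m) hA] with x h1 h2
  rw [h1, h2]
  by_cases hx : x ∈ A <;> simp [hx]

lemma eq_zero_iff_ae {v : M} : v = 0 ↔ ∀ᵐ x ∂m, M.pnorm v x = 0 := by
  rw [← norm_eq_zero, M.norm_eq, norm_eq_zero, Lp.eq_zero_iff_ae_eq_zero]
  rfl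

lemma eq_iff_ae {v w : M} : v = w ↔ ∀ᵐ x ∂m, M.pnorm (v - w) x = 0 := by
  rw [← sub_eq_zero, eq_zero_iff_ae]

lemma ae_neg (v : M) : ∀ᵐ x ∂m, M.pnorm (-v) x = M.pnorm v x := by
  filter_upwards [M.ae_smul (-1) v, AEEqFun.coeFn_neg (1 : X →ₘ[m] ℝ),
    AEEqFun.coeFn_one (μ := m) (β := ℝ)] with x h1 h2 h3
  rw [neg_smul, one_smul] at h1
  rw [h1]
  have : (-1 : Linf m).1 x = -1 := by
    refine h2.trans ?_
    rw [Pi.neg_apply, h3, Pi.one_apply]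
  rw [this]
  simp

lemma ae_sub_rev (v w : M) : ∀ᵐ x ∂m, M.pnorm (v - w) x = M.pnorm (w - v) x := by
  filter_upwards [M.ae_neg (w - v)] with x hx
  rw [← hx, neg_sub]

lemma chi_smul_eq_zero_iff {A : Set X} (hA : MeasurableSet A) {v : M} :
    chi m hA • v = 0 ↔ ∀ᵐ x ∂m, x ∈ A → M.pnorm v x = 0 := by
  rw [eq_zero_iff_ae]
  constructor
  · intro h
    filter_upwards [h, M.ae_chi_smul hA v] with x h1 h2 hx
    rw [← h1, h2, Set.indicator_of_mem hx]
  · intro h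
    filter_upwards [h, M.ae_chi_smul hA v] with x h1 h2
    rw [h2, Set.indicator_apply_eq_zero]
    exact h1

lemma chi_smul_eq_iff {A : Set X} (hA : MeasurableSet A) {v w : M} :
    chi m hA • v = chi m hA • w ↔ ∀ᵐ x ∂m, x ∈ A → M.pnorm (v - w) x = 0 := by
  rw [← sub_eq_zero, ← smul_sub, chi_smul_eq_zero_iff]

/-- The pointwise triangle inequality. It is not an axiom, but follows from the triangle inequality
for the norm: otherwise there are numbers `a + b < c` such that `|v| ≤ a`, `|w| ≤ b` and
`|v + w| ≥ c` on a set `A` of finite positive measure, which contradicts the triangle inequality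
for `χ_A v` and `χ_A w`. -/
lemma ae_add_le [SigmaFinite m] (v w : M) :
    ∀ᵐ x ∂m, M.pnorm (v + w) x ≤ M.pnorm v x + M.pnorm w x := by
  have key : ∀ a b c : ℚ, a + b < c →
      ∀ᵐ x ∂m, ¬ (M.pnorm v x ≤ a ∧ M.pnorm w x ≤ b ∧ c ≤ M.pnorm (v + w) x) := by
    intro a b c habc
    have hS : MeasurableSet {x | M.pnorm v x ≤ a ∧ M.pnorm w x ≤ b ∧ c ≤ M.pnorm (v + w) x} :=
      (measurableSet_le (M.measurable_pnorm v) measurable_const).inter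
        ((measurableSet_le (M.measurable_pnorm w) measurable_const).inter
          (measurableSet_le measurable_const (M.measurable_pnorm (v + w))))
    by_contra hne
    have hpos : 0 < m {x | M.pnorm v x ≤ a ∧ M.pnorm w x ≤ b ∧ c ≤ M.pnorm (v + w) x} := by
      refine pos_iff_ne_zero.2 fun h0 => hne ?_
      rw [ae_iff]
      simpa only [not_not] using h0
    obtain ⟨A, hA, hAS, hA0, hAt⟩ := Measure.exists_subset_measure_lt_top hS hpos
    set κ : Lp ℝ p m := indicatorConstLp p hA hAt.ne (1 : ℝ) with hκ
    have hκx : ∀ᵐ x ∂m, κ x = A.indicator (fun _ => (1 : ℝ)) x := indicatorConstLp_coeFn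
    have hκ0 : 0 < ‖κ‖ := by
      rw [norm_pos_iff]
      intro h0
      rw [Lp.eq_zero_iff_ae_eq_zero] at h0
      have : ∀ᵐ x ∂m, x ∉ A := by
        filter_upwards [hκx, h0] with x h1 h2 hx
        rw [h2, Set.indicator_of_mem hx] at h1
        simp at h1
      have h0' : m A = 0 := by
        rw [ae_iff] at this
        simpa using this
      exact hA0.ne' h0'
    -- upper and lower bounds on `A` turn into bounds for the norm
    have upper : ∀ (u : M) (t : ℚ), (∀ x ∈ A, M.pnorm u x ≤ t) → ‖chi m hA • u‖ ≤ t * ‖κ‖ := by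
      intro u t ht
      have ht0 : (0 : ℝ) ≤ t := by
        have hne : ∃ x, 0 ≤ M.pnorm u x ∧ x ∈ A := by
          by_contra hcon
          push Not at hcon
          refine hA0.ne' (measure_mono_null (fun x hx => ?_) (M.ae_nonneg u))
          exact fun h => hcon x h hx
        obtain ⟨x, hx, hxA⟩ := hne
        exact hx.trans (ht x hxA)
      rw [M.norm_eq, ← abs_of_nonneg ht0, ← Real.norm_eq_abs, ← norm_smul]
      refine Lp.norm_le_norm_of_ae_le ?_
      filter_upwards [M.ae_chi_smul hA u, hκx, Lp.coeFn_smul (t : ℝ) κ, M.ae_nonneg u]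
        with x h1 h2 h3 h4
      rw [h1, h3, Pi.smul_apply, h2, smul_eq_mul]
      by_cases hx : x ∈ A
      · simp only [Set.indicator_of_mem hx, mul_one, Real.norm_eq_abs, abs_of_nonneg h4,
          abs_of_nonneg ht0]
        exact ht x hx
      · simp [hx]
    have lower : (c : ℝ) * ‖κ‖ ≤ ‖chi m hA • (v + w)‖ := by
      refine (mul_le_mul_of_nonneg_right (le_abs_self _) (norm_nonneg _)).trans ?_
      by_cases hc : (0 : ℝ) ≤ c
      swap
      · exfalso
        have hne : ∃ x, (0 ≤ M.pnorm v x ∧ 0 ≤ M.pnorm w x) ∧ x ∈ A := by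
          by_contra hcon
          push Not at hcon
          refine hA0.ne' (measure_mono_null (fun x hx => ?_) ((M.ae_nonneg v).and (M.ae_nonneg w)))
          exact fun h => hcon x h hx
        obtain ⟨x, ⟨h1, h2⟩, hxA⟩ := hne
        have h3 := hAS hxA
        have h4 : (a : ℝ) + b < c := by exact_mod_cast habc
        linarith [h3.1, h3.2.1]
      rw [M.norm_eq, ← Real.norm_eq_abs, ← norm_smul]
      refine Lp.norm_le_norm_of_ae_le ?_
      filter_upwards [M.ae_chi_smul hA (v + w), hκx, Lp.coeFn_smul (c : ℝ) κ, M.ae_nonneg (v + w)]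
        with x h1 h2 h3 h4
      rw [h1, h3, Pi.smul_apply, h2, smul_eq_mul]
      by_cases hx : x ∈ A
      · simp only [Set.indicator_of_mem hx, mul_one, Real.norm_eq_abs, abs_of_nonneg h4,
          abs_of_nonneg hc]
        exact (hAS hx).2.2
      · simp [hx]
    have h1 := upper v a fun x hx => (hAS hx).1
    have h2 := upper w b fun x hx => (hAS hx).2.1
    have h3 := norm_add_le (chi m hA • v) (chi m hA • w)
    rw [← smul_add] at h3
    have h4 : (a : ℝ) + b < c := by exact_mod_cast habc
    nlinarith
  have key' : ∀ᵐ x ∂m, ∀ a b c : ℚ, a + b < c →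
      ¬ (M.pnorm v x ≤ a ∧ M.pnorm w x ≤ b ∧ c ≤ M.pnorm (v + w) x) := by
    simp only [ae_all_iff]
    exact key
  filter_upwards [key'] with x hx
  by_contra! hlt
  set δ := (M.pnorm (v + w) x - (M.pnorm v x + M.pnorm w x)) / 4 with hδ
  have hδ0 : 0 < δ := by linarith
  obtain ⟨a, ha1, ha2⟩ := exists_rat_btwn (lt_add_of_pos_right (M.pnorm v x) hδ0)
  obtain ⟨b, hb1, hb2⟩ := exists_rat_btwn (lt_add_of_pos_right (M.pnorm w x) hδ0)
  obtain ⟨c, hc1, hc2⟩ := exists_rat_btwn (sub_lt_self (M.pnorm (v + w) x) hδ0)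
  refine hx a b c ?_ ⟨ha1.le, hb1.le, hc2.le⟩
  have : (a : ℝ) + b < c := by linarith
  exact_mod_cast this

variable [SigmaFinite m]

lemma ae_le_add_sub (v w : M) : ∀ᵐ x ∂m, M.pnorm v x ≤ M.pnorm w x + M.pnorm (v - w) x := by
  simpa using M.ae_add_le w (v - w)

lemma ae_sub_le (u v w : M) :
    ∀ᵐ x ∂m, M.pnorm (u - w) x ≤ M.pnorm (u - v) x + M.pnorm (v - w) x := by
  simpa using M.ae_add_le (u - v) (v - w)

lemma ae_sum_le {ι : Type*} (s : Finset ι) (v : ι → M) :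
    ∀ᵐ x ∂m, M.pnorm (∑ i ∈ s, v i) x ≤ ∑ i ∈ s, M.pnorm (v i) x := by
  classical
  induction s using Finset.induction_on with
  | empty =>
    filter_upwards [M.eq_zero_iff_ae.1 (rfl : (0 : M) = 0)] with x hx
    simp [hx]
  | insert a s ha ih =>
    filter_upwards [ih, M.ae_add_le (v a) (∑ i ∈ s, v i)] with x h1 h2
    rw [Finset.sum_insert ha, Finset.sum_insert ha]
    linarith

end PreNMod

/-! ### Pointwise calculus for sections -/

namespace MBB

variable {m : Measure X} {T : MBB m}

/-- The fibre seminorms are seminorms almost everywhere. -/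
lemma ae_isSeminormFun (T : MBB m) :
    ∀ᵐ x ∂m, IsSeminormFun fun v : T.Fiber x => T.nrm ⟨x, v⟩ :=
  T.ae_isNormFun.mono fun _ h => h.isSeminormFun

/-- The values of a chosen representative of a class of sections. -/
def Gamma0.ev (s : T.Gamma0) : ∀ x, T.Fiber x :=
  (Quotient.out (s := QuotientAddGroup.leftRel T.nullSections) s).1

lemma Gamma0.measurable_ev (s : T.Gamma0) :
    Measurable fun x => (⟨x, s.ev x⟩ : Total T.dim) :=
  (Quotient.out (s := QuotientAddGroup.leftRel T.nullSections) s).2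

lemma Gamma0.mk_ev (s : T.Gamma0) : Gamma0.mk ⟨s.ev, s.measurable_ev⟩ = s :=
  Quotient.out_eq (s := QuotientAddGroup.leftRel T.nullSections) s

lemma Gamma0.ev_mk (s : T.sections) : ∀ᵐ x ∂m, (Gamma0.mk s).ev x = s.1 x :=
  Gamma0.mk_eq_mk.1 (Gamma0.mk_ev (Gamma0.mk s))

lemma Gamma0.ext_ae {s t : T.Gamma0} (h : ∀ᵐ x ∂m, s.ev x = t.ev x) : s = t := by
  rw [← s.mk_ev, ← t.mk_ev]
  exact Gamma0.mk_eq_mk.2 h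

lemma Gamma0.ev_add (s t : T.Gamma0) : ∀ᵐ x ∂m, (s + t).ev x = s.ev x + t.ev x := by
  have h := Gamma0.ev_mk (⟨s.ev, s.measurable_ev⟩ + ⟨t.ev, t.measurable_ev⟩ : T.sections)
  rw [map_add, Gamma0.mk_ev, Gamma0.mk_ev] at h
  exact h

lemma Gamma0.ev_neg (s : T.Gamma0) : ∀ᵐ x ∂m, (-s).ev x = -s.ev x := by
  have h := Gamma0.ev_mk (-⟨s.ev, s.measurable_ev⟩ : T.sections)
  rw [map_neg, Gamma0.mk_ev] at h
  exact h

lemma Gamma0.ev_zero : ∀ᵐ x ∂m, (0 : T.Gamma0).ev x = 0 := by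
  have h := Gamma0.ev_mk (0 : T.sections)
  rw [map_zero] at h
  exact h

lemma Gamma0.ev_smul (f : X →ₘ[m] ℝ) (s : T.Gamma0) : ∀ᵐ x ∂m, (f • s).ev x = f x • s.ev x := by
  have h := Gamma0.ev_mk
    (smulSection f f.stronglyMeasurable.measurable ⟨s.ev, s.measurable_ev⟩ : T.sections)
  rw [← smul_mk, Gamma0.mk_ev] at h
  exact h

lemma Gamma0.pnorm0_ev (s : T.Gamma0) : ∀ᵐ x ∂m, pnorm0 s x = T.nrm ⟨x, s.ev x⟩ := by
  have h := coeFn_pnorm0_mk (⟨s.ev, s.measurable_ev⟩ : T.sections)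
  rwa [Gamma0.mk_ev] at h

/-- The `i`-th coordinate of a section is a measurable function. -/
lemma measurable_coord_section {s : ∀ x, T.Fiber x}
    (hs : Measurable fun x => (⟨x, s x⟩ : Total T.dim)) (i : ℕ) :
    Measurable fun x => Total.coord i (⟨x, s x⟩ : Total T.dim) :=
  T.measurable_section_iff.1 hs i

lemma coord_apply (s : ∀ x, T.Fiber x) (x : X) (i : Fin (T.dim x)) :
    Total.coord i (⟨x, s x⟩ : Total T.dim) = s x i := by
  simp [Total.coord]

/-- A section is measurable if its coordinates are restrictions of measurable functions. -/
lemma measurable_section_of_coords {s : ∀ x, T.Fiber x} {F : ℕ → X → ℝ}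
    (hF : ∀ i, Measurable (F i)) (hs : ∀ x (i : Fin (T.dim x)), s x i = F i x) :
    Measurable fun x => (⟨x, s x⟩ : Total T.dim) := by
  refine T.measurable_section_iff.2 fun i => ?_
  have : (fun x => Total.coord i (⟨x, s x⟩ : Total T.dim)) =
      fun x => if i < T.dim x then F i x else 0 := by
    funext x
    by_cases h : i < T.dim x <;> simp [Total.coord, h, hs]
  rw [this]
  exact Measurable.ite (measurableSet_lt measurable_const T.measurable_dim) (hF i) measurable_const

section GammaP

variable {p : ℝ≥0∞} [Fact (1 ≤ p)]

/-- The values of a chosen representative of an `L^p`-section. -/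
def ev (s : gammaObj T p) : ∀ x, T.Fiber x := Gamma0.ev (Subtype.val (s : T.GammaP p))

lemma measurable_ev (s : gammaObj T p) : Measurable fun x => (⟨x, ev s x⟩ : Total T.dim) :=
  Gamma0.measurable_ev _

lemma ext_ae {s t : gammaObj T p} (h : ∀ᵐ x ∂m, ev s x = ev t x) : s = t :=
  Subtype.ext (Gamma0.ext_ae h)

lemma ev_add (s t : gammaObj T p) : ∀ᵐ x ∂m, ev (s + t) x = ev s x + ev t x :=
  Gamma0.ev_add _ _

lemma ev_neg (s : gammaObj T p) : ∀ᵐ x ∂m, ev (-s) x = -ev s x := Gamma0.ev_neg _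

lemma ev_sub (s t : gammaObj T p) : ∀ᵐ x ∂m, ev (s - t) x = ev s x - ev t x := by
  rw [sub_eq_add_neg]
  filter_upwards [ev_add s (-t), ev_neg t] with x h1 h2
  rw [h1, h2, sub_eq_add_neg]

lemma ev_zero : ∀ᵐ x ∂m, ev (0 : gammaObj T p) x = 0 := Gamma0.ev_zero

lemma ev_smul (f : Linf m) (s : gammaObj T p) : ∀ᵐ x ∂m, ev (f • s) x = f.1 x • ev s x :=
  Gamma0.ev_smul _ _

lemma ev_sum {ι : Type*} (S : Finset ι) (s : ι → gammaObj T p) :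
    ∀ᵐ x ∂m, ev (∑ i ∈ S, s i) x = ∑ i ∈ S, ev (s i) x := by
  classical
  induction S using Finset.induction_on with
  | empty => simpa using ev_zero
  | insert a S ha ih =>
    filter_upwards [ih, ev_add (s a) (∑ i ∈ S, s i)] with x h1 h2
    rw [Finset.sum_insert ha, Finset.sum_insert ha, h2, h1]

lemma pnorm_ev (s : gammaObj T p) :
    ∀ᵐ x ∂m, (gammaObj T p).pnorm s x = T.nrm ⟨x, ev s x⟩ := Gamma0.pnorm0_ev _

lemma ev_chi_smul {A : Set X} (hA : MeasurableSet A) (s : gammaObj T p) :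
    ∀ᵐ x ∂m, ev (chi m hA • s) x = A.indicator (fun _ => (1 : ℝ)) x • ev s x := by
  filter_upwards [ev_smul (chi m hA) s, coeFn_chi (m := m) hA] with x h1 h2
  rw [h1, h2]

lemma chi_smul_eq_iff_ev {A : Set X} (hA : MeasurableSet A) {s t : gammaObj T p} :
    chi m hA • s = chi m hA • t ↔ ∀ᵐ x ∂m, x ∈ A → ev s x = ev t x := by
  constructor
  · intro h
    filter_upwards [ev_chi_smul hA s, ev_chi_smul hA t] with x h1 h2 hx
    rw [h, h2] at h1
    simpa [hx] using h1.symm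
  · intro h
    refine ext_ae ?_
    filter_upwards [ev_chi_smul hA s, ev_chi_smul hA t, h] with x h1 h2 h3
    rw [h1, h2]
    by_cases hx : x ∈ A
    · rw [h3 hx]
    · simp [hx]

/-- The `L^p`-section defined by a measurable section whose pointwise norm is in `L^p`. -/
def ofSection (s : ∀ x, T.Fiber x) (hs : Measurable fun x => (⟨x, s x⟩ : Total T.dim))
    (h : MemLp (fun x => T.nrm ⟨x, s x⟩) p m) : gammaObj T p :=
  (⟨Gamma0.mk ⟨s, hs⟩, Lp.mem_Lp_iff_memLp.2 ((memLp_congr_ae (coeFn_pnorm0_mk ⟨s, hs⟩)).2 h)⟩ :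
    T.GammaP p)

lemma ev_ofSection {s : ∀ x, T.Fiber x} {hs : Measurable fun x => (⟨x, s x⟩ : Total T.dim)}
    {h : MemLp (fun x => T.nrm ⟨x, s x⟩) p m} : ∀ᵐ x ∂m, ev (ofSection s hs h) x = s x :=
  Gamma0.ev_mk _

lemma measurable_nrm_comp {s : ∀ x, T.Fiber x} (hs : Measurable fun x => (⟨x, s x⟩ : Total T.dim)) :
    Measurable fun x => T.nrm ⟨x, s x⟩ :=
  T.measurable_nrm.comp hs

end GammaP

end MBB

/-! ### The section modules are complete and have the locality and glueing properties -/

/-- Locality holds in every module with a pointwise norm. -/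
lemma PreNMod.locality {m : Measure X} {p : ℝ≥0∞} [Fact (1 ≤ p)] (M : PreNMod m p) :
    M.Locality := by
  intro v A hA h
  rw [M.chi_smul_eq_zero_iff]
  have h' : ∀ᵐ x ∂m, ∀ n, x ∈ A n → M.pnorm v x = 0 :=
    ae_all_iff.2 fun n => (M.chi_smul_eq_zero_iff (hA n)).1 (h n)
  filter_upwards [h'] with x hx hxA
  obtain ⟨n, hn⟩ := Set.mem_iUnion.1 hxA
  exact hx n hn

lemma ae_coeFn_sum {m : Measure X} {p : ℝ≥0∞} {ι : Type*} (S : Finset ι) (f : ι → Lp ℝ p m) :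
    ∀ᵐ x ∂m, (∑ i ∈ S, f i : Lp ℝ p m) x = ∑ i ∈ S, f i x := by
  classical
  induction S using Finset.induction_on with
  | empty => simp only [Finset.sum_empty]; exact Lp.coeFn_zero ℝ p m
  | insert a S ha ih =>
    filter_upwards [ih, Lp.coeFn_add (f a) (∑ i ∈ S, f i)] with x h1 h2
    rw [Finset.sum_insert ha, Finset.sum_insert ha, h2, Pi.add_apply, h1]

namespace MBB

variable {m : Measure X} (T : MBB m) (p : ℝ≥0∞) [Fact (1 ≤ p)]

lemma glueing_gammaObj : (gammaObj T p).Glueing := by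
  classical
  intro v A hA hdisj C hC
  have hC0 : 0 ≤ C := by simpa using hC 0
  obtain ⟨k, hk, hk'⟩ := exists_measurable_index A hA
  have hkA : ∀ x j, x ∈ A j → k x = j := fun x j hj => by
    by_contra hne
    exact (Set.disjoint_left.1 (hdisj hne) (hk' x j hj)) hj
  let s : ∀ x, T.Fiber x := fun x => if x ∈ A (k x) then ev (v (k x)) x else 0
  have hsm : Measurable fun x => (⟨x, s x⟩ : Total T.dim) := by
    refine measurable_section_of_coords (F := fun i x => if x ∈ ⋃ j, A j then
      Total.coord i (⟨x, ev (v (k x)) x⟩ : Total T.dim) else 0) (fun i => ?_) fun x i => ?_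
    · refine Measurable.ite (MeasurableSet.iUnion hA) ?_ measurable_const
      exact measurable_apply_index
        (F := fun j x => Total.coord i (⟨x, ev (v j) x⟩ : Total T.dim))
        (fun j => measurable_coord_section (measurable_ev (v j)) i) hk
    · have : x ∈ ⋃ j, A j ↔ x ∈ A (k x) := by
        rw [Set.mem_iUnion]
        exact ⟨fun ⟨j, hj⟩ => hk' x j hj, fun h => ⟨_, h⟩⟩
      by_cases hx : x ∈ A (k x) <;> simp [s, this, hx, Total.coord]
  -- the partial sums eventually agree with `s`
  have hlim : ∀ᵐ x ∂m, Tendsto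
      (fun N => (gammaObj T p).pnorm (∑ i ∈ Finset.range N, chi m (hA i) • v i) x) atTop
      (𝓝 (T.nrm ⟨x, s x⟩)) := by
    have h1 := ae_all_iff.2 fun N =>
      pnorm_ev (∑ i ∈ Finset.range N, chi m (hA i) • v i : gammaObj T p)
    have h2 := ae_all_iff.2 fun N => ev_sum (Finset.range N) fun i => chi m (hA i) • v i
    have h3 := ae_all_iff.2 fun i => ev_chi_smul (hA i) (v i)
    filter_upwards [h1, h2, h3] with x h1 h2 h3
    refine tendsto_const_nhds.congr' ?_
    filter_upwards [eventually_gt_atTop (k x)] with N hN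
    rw [h1, h2]
    congr 2
    rw [Finset.sum_congr rfl fun i _ => h3 i]
    rw [Finset.sum_eq_single_of_mem (k x) (Finset.mem_range.2 hN)]
    · by_cases hx : x ∈ A (k x) <;> simp [s, hx]
    · intro j _ hj
      have : x ∉ A j := fun hx => hj (hkA x j hx).symm
      simp [this]
  have hbound : eLpNorm (fun x => T.nrm ⟨x, s x⟩) p m ≤ ENNReal.ofReal C := by
    refine (Lp.eLpNorm_lim_le_liminf_eLpNorm (fun N => (Lp.aestronglyMeasurable _)) _ hlim).trans ?_
    refine liminf_le_of_frequently_le' (Frequently.of_forall fun N => ?_)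
    have h := hC N
    rw [(gammaObj T p).norm_eq, Lp.norm_def] at h
    exact (ENNReal.le_ofReal_iff_toReal_le (Lp.eLpNorm_ne_top _) hC0).2 h
  have hmem : MemLp (fun x => T.nrm ⟨x, s x⟩) p m :=
    ⟨(measurable_nrm_comp hsm).aestronglyMeasurable, hbound.trans_lt ENNReal.ofReal_lt_top⟩
  refine ⟨ofSection s hsm hmem, fun n => ?_, ?_⟩
  · rw [chi_smul_eq_iff_ev]
    filter_upwards [ev_ofSection (h := hmem) (hs := hsm)] with x hx hxn
    rw [hx]
    obtain rfl := hkA x n hxn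
    simp [s, hxn]
  · rw [(gammaObj T p).norm_eq, Lp.norm_def]
    refine ENNReal.toReal_le_of_le_ofReal hC0 ?_
    refine le_trans (le_of_eq (eLpNorm_congr_ae ?_)) hbound
    filter_upwards [pnorm_ev (ofSection s hsm hmem), ev_ofSection (h := hmem) (hs := hsm)]
      with x h1 h2
    rw [h1, h2]

/-- Riesz–Fischer for sections: an absolutely convergent series of `L^p`-sections converges
absolutely in a.e. fibre, since the fibres are finite-dimensional normed spaces. -/
lemma completeSpace_gammaObj : CompleteSpace (gammaObj T p) := by
  refine NormedAddCommGroup.completeSpace_of_summable_imp_tendsto fun u hu => ?_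
  set N : ℕ → Lp ℝ p m := fun n => (gammaObj T p).pnorm (u n) with hN
  have hsum : Summable N := Summable.of_norm (by simpa only [(gammaObj T p).norm_eq] using hu)
  set G : Lp ℝ p m := ∑' n, N n with hG
  have hle : ∀ᵐ x ∂m, ∀ K, ∑ n ∈ Finset.range K, N n x ≤ G x := by
    refine ae_all_iff.2 fun K => ?_
    have h : ∑ n ∈ Finset.range K, N n ≤ G :=
      hsum.sum_le_tsum _ fun n _ => (gammaObj T p).pnorm_nonneg _
    filter_upwards [(Lp.coeFn_le _ _).2 h, ae_coeFn_sum (Finset.range K) N] with x h1 h2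
    rwa [h2] at h1
  let s : ∀ x, T.Fiber x := fun x i => ∑' n, ev (u n) x i
  have hsm : Measurable fun x => (⟨x, s x⟩ : Total T.dim) := by
    refine measurable_section_of_coords
      (F := fun i x => ∑' n, Total.coord i (⟨x, ev (u n) x⟩ : Total T.dim)) (fun i => ?_)
      fun x i => ?_
    · exact Measurable.tsum fun n => measurable_coord_section (measurable_ev (u n)) i
    · exact tsum_congr fun n => (coord_apply _ _ _).symm
  -- the remainders of the series are bounded by those of the series of pointwise norms
  have key : ∀ᵐ x ∂m, ∀ K, T.nrm ⟨x, s x - ∑ n ∈ Finset.range K, ev (u n) x⟩ ≤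
      G x - ∑ n ∈ Finset.range K, N n x := by
    have h1 := ae_all_iff.2 fun n => pnorm_ev (u n)
    filter_upwards [hle, h1, T.ae_isNormFun] with x hle h1 hn
    have hNx : ∀ n, N n x = T.nrm ⟨x, ev (u n) x⟩ := h1
    have hs := hn.isSeminormFun
    obtain ⟨C, hC, hCv⟩ := hs.exists_norm_le_mul hn.eq_zero
    have hsumN : Summable fun n => N n x :=
      summable_of_sum_range_le (fun n => by rw [hNx]; exact T.nrm_nonneg _) hle
    have hsumv : Summable fun n => ev (u n) x :=
      Summable.of_norm_bounded (hsumN.mul_left C) fun n => by rw [hNx]; exact hCv _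
    have htend : Tendsto (fun L => ∑ n ∈ Finset.range L, ev (u n) x) atTop (𝓝 (s x)) := by
      have : s x = ∑' n, ev (u n) x := by
        funext i
        exact (tsum_apply hsumv).symm
      rw [this]
      exact hsumv.hasSum.tendsto_sum_nat
    intro K
    have hcont : Continuous fun v : T.Fiber x =>
        T.nrm ⟨x, v - ∑ n ∈ Finset.range K, ev (u n) x⟩ :=
      hs.continuous.comp (continuous_id.sub continuous_const)
    refine le_of_tendsto ((hcont.tendsto _).comp htend) ?_
    filter_upwards [eventually_ge_atTop K] with L hL
    have h2 : ∑ n ∈ Finset.range L, ev (u n) x - ∑ n ∈ Finset.range K, ev (u n) x =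
        ∑ n ∈ Finset.Ico K L, ev (u n) x := (Finset.sum_Ico_eq_sub _ hL).symm
    have h3 : ∑ n ∈ Finset.Ico K L, N n x =
      ∑ n ∈ Finset.range L, N n x - ∑ n ∈ Finset.range K, N n x := Finset.sum_Ico_eq_sub _ hL
    simp only [Function.comp_apply]
    rw [h2]
    refine (hs.sum_le _ _).trans ?_
    simp only [← hNx]
    rw [h3]
    linarith [hle L]
  have hmem : MemLp (fun x => T.nrm ⟨x, s x⟩) p m := by
    refine (Lp.memLp G).mono' (measurable_nrm_comp hsm).aestronglyMeasurable ?_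
    filter_upwards [key] with x hx
    have := hx 0
    rw [Real.norm_of_nonneg (T.nrm_nonneg _)]
    simpa using this
  refine ⟨ofSection s hsm hmem, ?_⟩
  rw [tendsto_iff_norm_sub_tendsto_zero]
  have hGlim : Tendsto (fun K => ‖∑ n ∈ Finset.range K, N n - G‖) atTop (𝓝 0) :=
    tendsto_iff_norm_sub_tendsto_zero.1 hsum.hasSum.tendsto_sum_nat
  refine squeeze_zero (fun _ => norm_nonneg _) (fun K => ?_) hGlim
  rw [norm_sub_rev, (gammaObj T p).norm_eq, norm_sub_rev _ G]
  refine Lp.norm_le_norm_of_ae_le ?_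
  filter_upwards [key, pnorm_ev (ofSection s hsm hmem - ∑ n ∈ Finset.range K, u n),
    ev_ofSection (h := hmem) (hs := hsm), ev_sub (ofSection s hsm hmem) (∑ n ∈ Finset.range K, u n),
    ev_sum (Finset.range K) u, Lp.coeFn_sub G (∑ n ∈ Finset.range K, N n),
    ae_coeFn_sum (Finset.range K) N] with x h1 h2 h3 h4 h5 h6 h7
  rw [h2, h6, h4, h3, h5, Pi.sub_apply, h7, Real.norm_of_nonneg (T.nrm_nonneg _)]
  exact (h1 K).trans (le_abs_self _)

lemma isNMod_gammaObj : (gammaObj T p).IsNMod :=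
  ⟨completeSpace_gammaObj T p, (gammaObj T p).locality, glueing_gammaObj T p⟩

end MBB

/-! ### Local bases of the section modules -/

/-- A `σ`-finite measure admits a strictly positive bounded function in `L^p`. -/
lemma exists_pos_memLp (m : Measure X) [SigmaFinite m] (p : ℝ≥0∞) [hp : Fact (1 ≤ p)] :
    ∃ g : X → ℝ, Measurable g ∧ (∀ x, 0 < g x) ∧ MemLp g p m := by
  obtain ⟨w, hw0, hwm, hwi⟩ := exists_pos_lintegral_lt_of_sigmaFinite m (one_ne_zero (α := ℝ≥0∞))
  have hgm : Measurable fun x => ((min (w x) 1 : NNReal) : ℝ) :=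
    (hwm.min measurable_const).coe_nnreal_real
  refine ⟨fun x => ((min (w x) 1 : NNReal) : ℝ), hgm, fun x => ?_, hgm.aestronglyMeasurable, ?_⟩
  · exact NNReal.coe_pos.2 (lt_min (hw0 x) one_pos)
  by_cases hpt : p = ∞
  · subst hpt
    refine (memLp_top_of_bound hgm.aestronglyMeasurable 1 (.of_forall fun x => ?_)).2
    rw [Real.norm_of_nonneg (NNReal.coe_nonneg _)]
    exact_mod_cast min_le_right _ _
  have hp0 : p ≠ 0 := (zero_lt_one.trans_le hp.out).ne'
  rw [eLpNorm_lt_top_iff_lintegral_rpow_enorm_lt_top hp0 hpt]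
  refine lt_of_le_of_lt (lintegral_mono fun x => ?_) (hwi.trans ENNReal.one_lt_top)
  have h1 : 1 ≤ p.toReal := by
    rw [← ENNReal.toReal_one]
    exact ENNReal.toReal_mono hpt hp.out
  have h2 : ‖((min (w x) 1 : NNReal) : ℝ)‖ₑ = ((min (w x) 1 : NNReal) : ℝ≥0∞) := by
    rw [Real.enorm_eq_ofReal (NNReal.coe_nonneg _), ENNReal.ofReal_coe_nnreal]
  simp only [h2]
  refine (ENNReal.rpow_le_self_of_le_one ?_ h1).trans ?_
  · exact_mod_cast min_le_right _ _
  · exact_mod_cast min_le_left _ _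

namespace MBB

variable {m : Measure X} (T : MBB m) (p : ℝ≥0∞) [Fact (1 ≤ p)]

/-- The coordinate sections, multiplied by a positive function `r` which makes them
`p`-integrable. -/
lemma exists_frame [SigmaFinite m] : ∃ (r : X → ℝ) (b : ℕ → gammaObj T p),
    Measurable r ∧ (∀ x, 0 < r x) ∧
    ∀ᵐ x ∂m, ∀ (i : ℕ) (j : Fin (T.dim x)), ev (b i) x j = if (j : ℕ) = i then r x else 0 := by
  obtain ⟨g, hgm, hg0, hgp⟩ := exists_pos_memLp m p
  let e : ℕ → ∀ x, T.Fiber x := fun i x j => if (j : ℕ) = i then 1 else 0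
  have hem : ∀ i, Measurable fun x => (⟨x, e i x⟩ : Total T.dim) := fun i =>
    measurable_section_of_coords (F := fun j _ => if j = i then 1 else 0)
      (fun _ => measurable_const) fun _ _ => rfl
  -- dividing by `R` makes the pointwise norms of all coordinate sections at most `1`
  let R : X → ℝ := fun x => 1 + ∑ i ∈ Finset.range (T.dim x), T.nrm ⟨x, e i x⟩
  have hRm : Measurable R := by
    refine measurable_const.add ?_
    refine measurable_apply_index
      (F := fun n x => ∑ i ∈ Finset.range n, T.nrm ⟨x, e i x⟩) (fun n => ?_) T.measurable_dim
    exact Finset.measurable_fun_sum _ fun i _ => measurable_nrm_comp (hem i)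
  have hR1 : ∀ x, 1 ≤ R x := fun x =>
    le_add_of_nonneg_right (Finset.sum_nonneg fun i _ => T.nrm_nonneg _)
  let r : X → ℝ := fun x => g x / R x
  have hrm : Measurable r := hgm.div hRm
  have hr0 : ∀ x, 0 < r x := fun x => div_pos (hg0 x) (zero_lt_one.trans_le (hR1 x))
  have hbm : ∀ i, Measurable fun x => (⟨x, r x • e i x⟩ : Total T.dim) := fun i =>
    measurable_section_of_coords (F := fun j x => r x * if j = i then 1 else 0)
      (fun _ => hrm.mul measurable_const) fun _ _ => rfl
  have hbp : ∀ i, MemLp (fun x => T.nrm ⟨x, r x • e i x⟩) p m := fun i => by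
    refine hgp.mono' (measurable_nrm_comp (hbm i)).aestronglyMeasurable ?_
    filter_upwards [T.ae_isNormFun] with x hx
    have h1 : T.nrm ⟨x, e i x⟩ ≤ R x := by
      by_cases hi : i < T.dim x
      · have := Finset.single_le_sum (f := fun i => T.nrm ⟨x, e i x⟩)
          (fun i _ => T.nrm_nonneg _) (Finset.mem_range.2 hi)
        exact this.trans (by simp [R])
      · have : e i x = 0 := by
          funext j
          have : (j : ℕ) ≠ i := fun h => hi (h ▸ j.2)
          simp [e, this]
        rw [this, hx.isSeminormFun.map_zero]
        exact zero_le_one.trans (hR1 x)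
    rw [Real.norm_of_nonneg (T.nrm_nonneg _), hx.smul_eq, abs_of_pos (hr0 x), div_mul_eq_mul_div,
      div_le_iff₀ (zero_lt_one.trans_le (hR1 x))]
    exact mul_le_mul_of_nonneg_left h1 (hg0 x).le
  refine ⟨r, fun i => ofSection _ (hbm i) (hbp i), hrm, hr0, ae_all_iff.2 fun i => ?_⟩
  filter_upwards [ev_ofSection (hs := hbm i) (h := hbp i)] with x hx j
  rw [hx]
  simp [e]

variable {T p}

lemma ev_linearCombination {n : ℕ} (f : Fin n → Linf m) (v : Fin n → gammaObj T p) :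
    ∀ᵐ x ∂m, ev (∑ i, f i • v i) x = ∑ i, (f i).1 x • ev (v i) x := by
  filter_upwards [ev_sum Finset.univ fun i => f i • v i,
    ae_all_iff.2 fun i => ev_smul (f i) (v i)] with x h1 h2
  rw [h1, Finset.sum_congr rfl fun i _ => h2 i]

lemma frame_sum_apply {r : X → ℝ} {b : ℕ → gammaObj T p} {x : X}
    (hb : ∀ (i : ℕ) (j : Fin (T.dim x)), ev (b i) x j = if (j : ℕ) = i then r x else 0)
    {n : ℕ} (hn : T.dim x = n) (a : Fin n → ℝ) (j : Fin (T.dim x)) :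
    (∑ i : Fin n, a i • ev (b i) x) j = a (Fin.cast hn j) * r x := by
  rw [Finset.sum_apply, Finset.sum_eq_single (Fin.cast hn j)]
  · simp [hb]
  · intro i _ hi
    have : (j : ℕ) ≠ i := fun h => hi (Fin.ext h.symm)
    simp [hb, this]
  · simp

lemma independentOn_frame {r : X → ℝ} {b : ℕ → gammaObj T p} (hr0 : ∀ x, 0 < r x)
    (hb : ∀ᵐ x ∂m, ∀ (i : ℕ) (j : Fin (T.dim x)), ev (b i) x j = if (j : ℕ) = i then r x else 0)
    {n : ℕ} {A : Set X} (hA : MeasurableSet A) (hAn : ∀ x ∈ A, T.dim x = n) :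
    (gammaObj T p).IndependentOn (fun i : Fin n => b i) hA := by
  intro f hf i
  have hf' : chi m hA • ∑ i, f i • b i = chi m hA • (0 : gammaObj T p) := by
    rw [smul_zero]; exact hf
  rw [chi_smul_eq_iff_ev] at hf'
  refine Linf.ext_ae ?_
  filter_upwards [hf', hb, ev_linearCombination f fun i : Fin n => b i, coeFn_chi (m := m) hA,
    Linf.coeFn_mul (chi m hA) (f i), Linf.coeFn_zero (m := m), ev_zero (T := T) (p := p)]
    with x h1 h2 h3 h4 h5 h6 h7
  rw [h5, h6, h4]
  by_cases hx : x ∈ A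
  · have hn := hAn x hx
    have h8 := congrFun ((h3.symm.trans (h1 hx)).trans h7) (Fin.cast hn.symm i)
    rw [frame_sum_apply h2 hn (fun i => (f i).1 x)] at h8
    simp only [Pi.zero_apply, mul_eq_zero, (hr0 x).ne', or_false] at h8
    rw [show (f i).1 x = 0 from h8, mul_zero]
  · simp [hx]

lemma spansOn_frame {r : X → ℝ} {b : ℕ → gammaObj T p} (hrm : Measurable r) (hr0 : ∀ x, 0 < r x)
    (hb : ∀ᵐ x ∂m, ∀ (i : ℕ) (j : Fin (T.dim x)), ev (b i) x j = if (j : ℕ) = i then r x else 0)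
    {n : ℕ} {A : Set X} (hA : MeasurableSet A) (hAn : ∀ x ∈ A, T.dim x = n) :
    (gammaObj T p).SpansOn (fun i : Fin n => b i) A := by
  classical
  intro w
  let c : ℕ → X → ℝ := fun i x => Total.coord i (⟨x, ev w x⟩ : Total T.dim) / r x
  have hcm : ∀ i, Measurable (c i) := fun i =>
    (measurable_coord_section (measurable_ev w) i).div hrm
  -- the coefficients `c i` of `w` are bounded on the level sets of `k`
  let k : X → ℕ := fun x => ⌈∑ i ∈ Finset.range n, |c i x|⌉₊
  have hkm : Measurable k :=
    (Finset.measurable_fun_sum _ fun i _ => (hcm i).abs).nat_ceil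
  have hBm : ∀ j, MeasurableSet (A ∩ k ⁻¹' {j}) := fun j =>
    hA.inter (hkm (measurableSet_singleton j))
  refine ⟨fun j => A ∩ k ⁻¹' {j}, hBm, fun i j hij => ?_, ?_, fun j => ?_⟩
  · refine Set.disjoint_left.2 ?_
    rintro x ⟨-, hi⟩ ⟨-, hj⟩
    exact hij (hi.symm.trans hj)
  · ext x; simp
  have hbd : ∀ i : Fin n, ∃ C, ∀ x, |(A ∩ k ⁻¹' {j}).indicator (c i) x| ≤ C := by
    refine fun i => ⟨j, fun x => ?_⟩
    by_cases hx : x ∈ A ∩ k ⁻¹' {j}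
    · rw [Set.indicator_of_mem hx]
      have h1 : |c i x| ≤ ∑ i ∈ Finset.range n, |c i x| :=
        Finset.single_le_sum (f := fun i => |c i x|) (fun _ _ => abs_nonneg _)
          (Finset.mem_range.2 i.2)
      refine h1.trans ((Nat.le_ceil _).trans ?_)
      exact_mod_cast (show k x = j from hx.2).le
    · simp [hx]
  refine ⟨fun i => Linf.ofBounded m _ ((hcm i).indicator (hBm j)) (hbd i), ?_⟩
  rw [chi_smul_eq_iff_ev]
  filter_upwards [hb, ev_linearCombination
      (fun i : Fin n => Linf.ofBounded m _ ((hcm i).indicator (hBm j)) (hbd i)) fun i => b i,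
    ae_all_iff.2 fun i : Fin n => Linf.coeFn_ofBounded (m := m) ((hcm i).indicator (hBm j)) (hbd i)]
    with x h1 h2 h3 hx
  have hn := hAn x hx.1
  rw [h2]
  funext l
  rw [frame_sum_apply h1 hn (fun i => (Linf.ofBounded m _ ((hcm i).indicator (hBm j)) (hbd i)).1 x)]
  simp only [h3, Set.indicator_of_mem hx, c]
  rw [div_mul_cancel₀ _ (hr0 x).ne', Fin.val_cast, coord_apply]

variable (T p) [SigmaFinite m]

lemma isProper_gammaObj : (gammaObj T p).IsProper := by
  obtain ⟨r, b, hrm, hr0, hb⟩ := T.exists_frame p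
  have hEm : ∀ e : ℕ∞, MeasurableSet {x | (T.dim x : ℕ∞) = e} := fun e =>
    T.measurable_dim (MeasurableSet.of_discrete (s := {k : ℕ | (k : ℕ∞) = e}))
  refine ⟨fun e => {x | (T.dim x : ℕ∞) = e}, ⟨hEm, fun i j hij => ?_, ?_, fun n _ => ?_, ?_⟩, ?_⟩
  · refine Set.disjoint_left.2 ?_
    rintro x hi hj
    exact hij (hi.symm.trans hj)
  · ext x; simp
  · have hn : ∀ x ∈ {x | (T.dim x : ℕ∞) = n}, T.dim x = n := fun x hx => by simpa using hx
    exact ⟨_, independentOn_frame hr0 hb (hEm n) hn, spansOn_frame hrm hr0 hb (hEm n) hn⟩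
  · intro A hA hAE hA0
    have : A = ∅ := Set.subset_eq_empty hAE (by ext x; simp)
    simp [this] at hA0
  · simp

lemma isProperNMod_gammaObj : isProperNMod m p (gammaObj T p) :=
  ⟨isNMod_gammaObj T p, isProper_gammaObj T p⟩

end MBB

/-! ### The section functor is fully faithful -/

namespace MBB

variable {m : Measure X} {p : ℝ≥0∞} [Fact (1 ≤ p)] {T₁ T₂ : MBB m}

lemma ev_gammaMap (φ : PreHom T₁ T₂) (s : gammaObj T₁ p) :
    ∀ᵐ x ∂m, ev ((gammaMap p (⟦φ⟧ : T₁ ⟶ T₂)).toLinearMap s) x = φ.app x (ev s x) := by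
  have h := Gamma0.ev_mk (φ.onSection ⟨ev s, measurable_ev s⟩)
  rw [← gammaMap0_mk] at h
  have h2 : Gamma0.mk (⟨ev s, measurable_ev s⟩ : T₁.sections) = Subtype.val (s : T₁.GammaP p) :=
    Gamma0.mk_ev _
  rw [h2] at h
  exact h

lemma frame_eq_smul_single {r : X → ℝ} {b : ℕ → gammaObj T₁ p} {x : X}
    (hb : ∀ (i : ℕ) (j : Fin (T₁.dim x)), ev (b i) x j = if (j : ℕ) = i then r x else 0)
    (i : Fin (T₁.dim x)) : ev (b i) x = r x • Pi.single i 1 := by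
  funext j
  rw [hb]
  by_cases hij : j = i
  · simp [hij]
  · have : (j : ℕ) ≠ i := fun h => hij (Fin.ext h)
    simp [hij, this]

/-- A morphism of section modules commutes with locally finite combinations of a frame. -/
lemma ev_map_eq_sum {r : X → ℝ} {b : ℕ → gammaObj T₁ p} (hrm : Measurable r) (hr0 : ∀ x, 0 < r x)
    (hb : ∀ᵐ x ∂m, ∀ (i : ℕ) (j : Fin (T₁.dim x)), ev (b i) x j = if (j : ℕ) = i then r x else 0)
    (Φ : gammaObj T₁ p ⟶ gammaObj T₂ p) (s : gammaObj T₁ p) :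
    ∀ᵐ x ∂m, ev (Φ.toLinearMap s) x =
      ∑ i : Fin (T₁.dim x), (ev s x i / r x) • ev (Φ.toLinearMap (b i)) x := by
  have hA : ∀ n, MeasurableSet {x | T₁.dim x = n} := fun n =>
    T₁.measurable_dim (measurableSet_singleton n)
  have hspan := fun n => spansOn_frame hrm hr0 hb (hA n) (fun _ h => h) s
  choose B hB hdisj hU f hf using hspan
  have h1 : ∀ᵐ x ∂m, ∀ n k, x ∈ B n k →
      ev s x = ev (∑ i, f n k i • b i : gammaObj T₁ p) x :=
    ae_all_iff.2 fun n => ae_all_iff.2 fun k => (chi_smul_eq_iff_ev (hB n k)).1 (hf n k)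
  have h2 : ∀ᵐ x ∂m, ∀ n k, x ∈ B n k → ev (Φ.toLinearMap s) x =
      ev (∑ i, f n k i • Φ.toLinearMap (b i) : gammaObj T₂ p) x := by
    refine ae_all_iff.2 fun n => ae_all_iff.2 fun k => (chi_smul_eq_iff_ev (hB n k)).1 ?_
    have h := congrArg Φ.toLinearMap (hf n k)
    simpa only [map_smul, map_sum] using h
  have h3 := ae_all_iff.2 fun n => ae_all_iff.2 fun k =>
    ev_linearCombination (f n k) fun i : Fin n => b i
  have h4 := ae_all_iff.2 fun n => ae_all_iff.2 fun k =>
    ev_linearCombination (f n k) fun i : Fin n => Φ.toLinearMap (b i)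
  filter_upwards [h1, h2, h3, h4, hb] with x h1 h2 h3 h4 hb
  have hx : x ∈ ⋃ k, B (T₁.dim x) k := by rw [hU]; rfl
  obtain ⟨k, hk⟩ := Set.mem_iUnion.1 hx
  rw [h2 _ k hk, h4]
  refine Finset.sum_congr rfl fun i _ => ?_
  have h5 := congrFun ((h1 _ k hk).trans (h3 _ k)) i
  rw [frame_sum_apply hb rfl (fun i => (f (T₁.dim x) k i).1 x)] at h5
  rw [h5, mul_div_cancel_right₀ _ (hr0 x).ne']
  rfl

variable (m p) [SigmaFinite m]

instance faithful_sectionFunctor : (sectionFunctor m p).Faithful where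
  map_injective {T₁ T₂ φ ψ} h := by
    induction φ using Quotient.inductionOn with | _ φ => ?_
    induction ψ using Quotient.inductionOn with | _ ψ => ?_
    refine Quotient.sound ?_
    change ∀ᵐ x ∂m, φ.app x = ψ.app x
    obtain ⟨r, b, hrm, hr0, hb⟩ := T₁.exists_frame p
    have h' : gammaMap p (⟦φ⟧ : T₁ ⟶ T₂) = gammaMap p (⟦ψ⟧ : T₁ ⟶ T₂) := h
    have h1 : ∀ᵐ x ∂m, ∀ i, φ.app x (ev (b i) x) = ψ.app x (ev (b i) x) := by
      refine ae_all_iff.2 fun i => ?_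
      filter_upwards [ev_gammaMap φ (b i), ev_gammaMap ψ (b i)] with x h2 h3
      rw [← h2, ← h3, h']
    filter_upwards [h1, hb, φ.ae_linear, ψ.ae_linear] with x h1 h2 h3 h4
    have h5 : h3.mk' _ = h4.mk' _ := by
      refine LinearMap.pi_ext' fun i => LinearMap.ext_ring ?_
      have h6 := h1 i
      rw [frame_eq_smul_single h2, h3.map_smul, h4.map_smul] at h6
      exact smul_right_injective _ (hr0 x).ne' h6
    funext v
    exact LinearMap.congr_fun h5 v

/-- A morphism `Φ` of section modules is determined by the images of a frame `b`; reading these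
images pointwise gives the bundle morphism. The inequality `|Φ(u)| ≤ |u|` for the countably many
rational combinations `u` of the frame shows that it is 1-Lipschitz on a.e. fibre. -/
instance full_sectionFunctor : (sectionFunctor m p).Full where
  map_surjective {T₁ T₂} Φ := by
    obtain ⟨r, b, hrm, hr0, hb⟩ := T₁.exists_frame p
    change gammaObj T₁ p ⟶ gammaObj T₂ p at Φ
    let β : ℕ → ∀ x, T₂.Fiber x := fun i => ev (Φ.toLinearMap (b i))
    let app : ∀ x, T₁.Fiber x → T₂.Fiber x := fun x v => ∑ i, (v i / r x) • β i x
    have happ_lin : ∀ x, IsLinearMap ℝ (app x) := fun x =>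
      ⟨fun v w => by simp only [app, Pi.add_apply, add_div, add_smul, Finset.sum_add_distrib],
        fun c v => by
          simp only [app, Pi.smul_apply, smul_eq_mul, mul_div_assoc, mul_smul, Finset.smul_sum]⟩
    have happ_meas : Measurable fun t : Total T₁.dim =>
        (⟨t.base, app t.base t.vec⟩ : Total T₂.dim) := by
      rw [Total.measurable_iff T₂.measurable_dim]
      refine ⟨Total.measurable_base, fun j => ?_⟩
      have : (fun t : Total T₁.dim => Total.coord j (⟨t.base, app t.base t.vec⟩ : Total T₂.dim)) =
          fun t => ∑ i ∈ Finset.range (T₁.dim t.base), (Total.coord i t / r t.base) *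
            Total.coord j (⟨t.base, β i t.base⟩ : Total T₂.dim) := by
        funext t
        rw [Finset.sum_range]
        by_cases hj : j < T₂.dim t.base <;> simp [Total.coord, hj, app]
      rw [this]
      refine measurable_apply_index (F := fun n (t : Total T₁.dim) => ∑ i ∈ Finset.range n,
        (Total.coord i t / r t.base) * Total.coord j (⟨t.base, β i t.base⟩ : Total T₂.dim))
        (fun n => ?_) (T₁.measurable_dim.comp Total.measurable_base)
      refine Finset.measurable_fun_sum _ fun i _ => ?_
      refine ((Total.measurable_coord i).div (hrm.comp Total.measurable_base)).mul ?_
      exact (measurable_coord_section (measurable_ev (Φ.toLinearMap (b i))) j).comp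
        Total.measurable_base
    have hcontr : ∀ᵐ x ∂m, ∀ v, T₂.nrm ⟨x, app x v⟩ ≤ T₁.nrm ⟨x, v⟩ := by
      let u : ∀ n, (Fin n → ℚ) → gammaObj T₁ p := fun n q =>
        ∑ i, Linf.const m (q i : ℝ) • b i
      have h1 : ∀ᵐ x ∂m, ∀ n (q : Fin n → ℚ), T₂.nrm ⟨x, ev (Φ.toLinearMap (u n q)) x⟩ ≤
          T₁.nrm ⟨x, ev (u n q) x⟩ := by
        refine ae_all_iff.2 fun n => ae_all_iff.2 fun q => ?_
        filter_upwards [(Lp.coeFn_le _ _).2 (Φ.pnorm_le (u n q)), pnorm_ev (u n q),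
          pnorm_ev (Φ.toLinearMap (u n q))] with x h2 h3 h4
        rwa [h3, h4] at h2
      have h2 := ae_all_iff.2 fun n => ae_all_iff.2 fun q : Fin n → ℚ =>
        ev_linearCombination (fun i => Linf.const m (q i : ℝ)) fun i : Fin n => b i
      have h3 := ae_all_iff.2 fun n => ae_all_iff.2 fun q : Fin n → ℚ =>
        ev_map_eq_sum hrm hr0 hb Φ (u n q)
      have h4 := ae_all_iff.2 fun q : ℚ => Linf.coeFn_const (m := m) (q : ℝ)
      filter_upwards [h1, h2, h3, h4, hb, T₁.ae_isSeminormFun, T₂.ae_isSeminormFun]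
        with x h1 h2 h3 h4 hb hs1 hs2 v
      have hr := hr0 x
      have hcont : Continuous (app x) :=
        (happ_lin x).mk'.continuous_of_finiteDimensional
      refine (denseRange_ratCast_pi (T₁.dim x)).induction_on
        (p := fun v => T₂.nrm ⟨x, app x v⟩ ≤ T₁.nrm ⟨x, v⟩) v ?_ fun q => ?_
      · exact isClosed_le (hs2.continuous.comp hcont) hs1.continuous
      have h5 := h1 _ q
      rw [h3] at h5
      change T₂.nrm ⟨x, app x (ev (u _ q) x)⟩ ≤ _ at h5
      have h6 : ev (u _ q) x = r x • fun i => (q i : ℝ) := by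
        rw [h2]
        funext j
        rw [frame_sum_apply hb rfl (fun i => (Linf.const m (q i : ℝ)).1 x)]
        simp only [h4, Pi.smul_apply, smul_eq_mul]
        exact mul_comm _ _
      rw [h6, (happ_lin x).map_smul, hs1.smul_eq, hs2.smul_eq, abs_of_pos hr] at h5
      exact le_of_mul_le_mul_left h5 hr
    let φ : PreHom T₁ T₂ :=
      { app := app
        measurable := happ_meas
        ae_linear := .of_forall happ_lin
        ae_lipschitz := by
          filter_upwards [hcontr] with x hx v w
          rw [← (happ_lin x).map_sub]
          exact hx _ }
    refine ⟨(⟦φ⟧ : T₁ ⟶ T₂), ?_⟩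
    refine PreNMod.Hom.ext (LinearMap.ext fun s => ext_ae ?_)
    filter_upwards [ev_gammaMap φ s, ev_map_eq_sum hrm hr0 hb Φ s] with x h1 h2
    exact h1.trans h2.symm

end MBB

/-! ### Fibre norms read off from elements of a module -/

namespace PreNMod

variable {m : Measure X} {p : ℝ≥0∞} [Fact (1 ≤ p)] (M : PreNMod m p)

/-- The linear combination of `v₁, …, vₙ` with constant rational coefficients. -/
def ratComb {n : ℕ} (v : Fin n → M) (q : Fin n → ℚ) : M := ∑ i, Linf.const m (q i : ℝ) • v i

/-- The seminorm `c ↦ |∑ cᵢ vᵢ|(x)` on `ℝⁿ`. It is computed from rational coefficients only, so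
that a.e. defined quantities may be used. -/
def fiberNorm {n : ℕ} (v : Fin n → M) (x : X) : (Fin n → ℝ) → ℝ :=
  ratExtend fun q => M.pnorm (M.ratComb v q) x

lemma ratComb_add {n : ℕ} (v : Fin n → M) (q r : Fin n → ℚ) :
    M.ratComb v (q + r) = M.ratComb v q + M.ratComb v r := by
  simp only [ratComb, Pi.add_apply, Rat.cast_add, Linf.const_add, add_smul, Finset.sum_add_distrib]

lemma ratComb_smul {n : ℕ} (v : Fin n → M) (a : ℚ) (q : Fin n → ℚ) :
    M.ratComb v (a • q) = Linf.const m (a : ℝ) • M.ratComb v q := by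
  simp only [ratComb, Pi.smul_apply, smul_eq_mul, Rat.cast_mul, Linf.const_mul, mul_smul,
    Finset.smul_sum]

lemma measurable_fiberNorm {n : ℕ} (v : Fin n → M) {Y : Type*} [MeasurableSpace Y] {x : Y → X}
    {c : Y → Fin n → ℝ} (hx : Measurable x) (hc : Measurable c) :
    Measurable fun y => M.fiberNorm v (x y) (c y) :=
  measurable_ratExtend (fun _ => (M.measurable_pnorm _).comp hx) hc

variable [SigmaFinite m]

lemma ae_isRatSeminorm {n : ℕ} (v : Fin n → M) :
    ∀ᵐ x ∂m, IsRatSeminorm fun q => M.pnorm (M.ratComb v q) x := by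
  have h1 := ae_all_iff.2 fun q => ae_all_iff.2 fun r =>
    M.ae_add_le (M.ratComb v q) (M.ratComb v r)
  have h2 := ae_all_iff.2 fun a : ℚ => ae_all_iff.2 fun q =>
    M.ae_const_smul (a : ℝ) (M.ratComb v q)
  filter_upwards [h1, h2] with x h1 h2
  refine ⟨fun q r => ?_, fun a q => ?_⟩
  · rw [ratComb_add]; exact h1 q r
  · rw [ratComb_smul]; exact h2 a q

lemma ae_isSeminormFun_fiberNorm {n : ℕ} (v : Fin n → M) :
    ∀ᵐ x ∂m, IsSeminormFun (M.fiberNorm v x) :=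
  (M.ae_isRatSeminorm v).mono fun _ h => h.isSeminormFun_ratExtend

/-- The pointwise norm of an `L^∞`-linear combination is given by the fibre seminorms: both sides
depend continuously on the coefficients and agree for rational ones. -/
lemma ae_pnorm_sum_smul {n : ℕ} (v : Fin n → M) (f : Fin n → Linf m) :
    ∀ᵐ x ∂m, M.pnorm (∑ i, f i • v i) x = M.fiberNorm v x fun i => (f i).1 x := by
  have hdiff : ∀ q : Fin n → ℚ, ∑ i, f i • v i - M.ratComb v q =
      ∑ i, (f i - Linf.const m (q i : ℝ)) • v i := fun q => by
    simp only [ratComb, sub_smul, Finset.sum_sub_distrib]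
  have h1 : ∀ᵐ x ∂m, ∀ q : Fin n → ℚ,
      M.pnorm (∑ i, f i • v i - M.ratComb v q) x ≤ ∑ i, |(f i).1 x - q i| * M.pnorm (v i) x := by
    refine ae_all_iff.2 fun q => ?_
    rw [hdiff]
    filter_upwards [M.ae_sum_le Finset.univ fun i => (f i - Linf.const m (q i : ℝ)) • v i,
      ae_all_iff.2 fun i => M.ae_smul (f i - Linf.const m (q i : ℝ)) (v i),
      ae_all_iff.2 fun i => Linf.coeFn_sub (f i) (Linf.const m (q i : ℝ)),
      ae_all_iff.2 fun i => Linf.coeFn_const (m := m) (q i : ℝ)] with x h2 h3 h4 h5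
    refine h2.trans (le_of_eq (Finset.sum_congr rfl fun i _ => ?_))
    rw [h3, h4, h5]
  have h2 := ae_all_iff.2 fun q => M.ae_le_add_sub (∑ i, f i • v i) (M.ratComb v q)
  have h3 := ae_all_iff.2 fun q => M.ae_le_add_sub (M.ratComb v q) (∑ i, f i • v i)
  have h4 := ae_all_iff.2 fun q => M.ae_sub_rev (M.ratComb v q) (∑ i, f i • v i)
  filter_upwards [h1, h2, h3, h4, M.ae_isRatSeminorm v] with x h1 h2 h3 h4 h5
  have key : ∀ c : Fin n → ℝ, |M.pnorm (∑ i, f i • v i) x - M.fiberNorm v x c| ≤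
      ∑ i, |(f i).1 x - c i| * M.pnorm (v i) x := by
    intro c
    have hc := h5.isSeminormFun_ratExtend.continuous
    refine (denseRange_ratCast_pi n).induction_on (p := fun c =>
      |M.pnorm (∑ i, f i • v i) x - M.fiberNorm v x c| ≤
        ∑ i, |(f i).1 x - c i| * M.pnorm (v i) x) c ?_ fun q => ?_
    · exact isClosed_le (continuous_const.sub hc).abs (by fun_prop)
    · have h6 : M.fiberNorm v x (fun i => (q i : ℝ)) = _ := h5.ratExtend_eq q
      rw [h6, abs_le]
      have h7 := h1 q
      have h8 := h2 q
      have h9 := h3 q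
      have h10 := h4 q
      constructor <;> linarith
  have := key fun i => (f i).1 x
  simp only [sub_self, abs_zero, zero_mul, Finset.sum_const_zero] at this
  exact sub_eq_zero.1 (abs_eq_zero.1 (le_antisymm this (abs_nonneg _)))

lemma ae_pnorm_sum_smul_sub_ratComb {n : ℕ} (v : Fin n → M) (f : Fin n → Linf m) :
    ∀ᵐ x ∂m, ∀ q : Fin n → ℚ, M.pnorm (∑ i, f i • v i - M.ratComb v q) x =
      M.fiberNorm v x fun i => (f i).1 x - q i := by
  refine ae_all_iff.2 fun q => ?_
  have hdiff : ∑ i, f i • v i - M.ratComb v q =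
      ∑ i, (f i - Linf.const m (q i : ℝ)) • v i := by
    simp only [ratComb, sub_smul, Finset.sum_sub_distrib]
  rw [hdiff]
  filter_upwards [M.ae_pnorm_sum_smul v fun i => f i - Linf.const m (q i : ℝ),
    ae_all_iff.2 fun i => Linf.coeFn_sub (f i) (Linf.const m (q i : ℝ)),
    ae_all_iff.2 fun i => Linf.coeFn_const (m := m) (q i : ℝ)] with x h1 h2 h3
  rw [h1]
  simp only [h2, h3]

/-- If `v₁, …, vₙ` are independent on `A`, the fibre seminorms are norms a.e. on `A`: the
coordinates of a measurable field of kernel vectors, rescaled to be bounded, are the coefficients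
of a linear relation. -/
lemma IndependentOn.ae_fiberNorm_eq_zero {M : PreNMod m p} {n : ℕ} {v : Fin n → M} {A : Set X}
    {hA : MeasurableSet A} (h : M.IndependentOn v hA) :
    ∀ᵐ x ∂m, x ∈ A → ∀ c, M.fiberNorm v x c = 0 → c = 0 := by
  classical
  set S : Set X := {x | ¬ IsSeminormFun (M.fiberNorm v x)} with hS
  have hS0 : m (toMeasurable m S) = 0 := by
    rw [measure_toMeasurable]
    exact M.ae_isSeminormFun_fiberNorm v
  have hmeas := measurableSet_toMeasurable m S
  have hnot : ∀ᵐ x ∂m, x ∉ toMeasurable m S := measure_eq_zero_iff_ae_notMem.1 hS0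
  have hsemi : ∀ x ∉ toMeasurable m S, IsSeminormFun (M.fiberNorm v x) := fun x hx => by
    by_contra hcon
    exact hx (subset_toMeasurable m S hcon)
  obtain ⟨c, hcm, hc⟩ := exists_measurable_kernel_vector n
    (fun x => if x ∈ toMeasurable m S then fun _ => 0 else M.fiberNorm v x)
    (fun c => by
      have : (fun x => (if x ∈ toMeasurable m S then fun _ => 0 else M.fiberNorm v x) c) =
          fun x => if x ∈ toMeasurable m S then 0 else M.fiberNorm v x c := by
        funext x; split_ifs <;> rfl
      rw [this]
      exact Measurable.ite hmeas measurable_const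
        (M.measurable_fiberNorm v measurable_id measurable_const))
    (fun x => by
      by_cases hx : x ∈ toMeasurable m S
      · simp only [hx, if_true]
        exact ⟨fun _ _ => by simp, fun _ _ => by simp⟩
      · simp only [hx, if_false]
        exact hsemi x hx)
  have hnorm : ∀ x, 0 < 1 + ‖c x‖ := fun x => by positivity
  have hfm : ∀ i, Measurable fun x => (1 + ‖c x‖)⁻¹ * c x i := fun i =>
    (measurable_const.add hcm.norm).inv.mul ((measurable_pi_apply i).comp hcm)
  have hfb : ∀ i, ∃ C, ∀ x, |(1 + ‖c x‖)⁻¹ * c x i| ≤ C := fun i => ⟨1, fun x => by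
    rw [abs_mul, abs_of_pos (inv_pos.2 (hnorm x)), inv_mul_le_iff₀ (hnorm x), mul_one]
    exact (norm_le_pi_norm (c x) i).trans (by linarith)⟩
  have hzero : ∑ i, Linf.ofBounded m _ (hfm i) (hfb i) • v i = 0 := by
    rw [M.eq_zero_iff_ae]
    filter_upwards [M.ae_pnorm_sum_smul v fun i => Linf.ofBounded m _ (hfm i) (hfb i),
      ae_all_iff.2 fun i => Linf.coeFn_ofBounded (m := m) (hfm i) (hfb i), hnot] with x h1 h2 h3
    rw [h1]
    simp only [h2]
    have h4 := (hc x).1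
    simp only [h3, if_false] at h4
    have h5 := (hsemi x h3).smul_eq (1 + ‖c x‖)⁻¹ (c x)
    rw [h4, mul_zero] at h5
    exact h5
  have hrel := h (fun i => Linf.ofBounded m _ (hfm i) (hfb i)) (by rw [hzero, smul_zero])
  filter_upwards [hnot, ae_all_iff.2 fun i => Linf.coeFn_ofBounded (m := m) (hfm i) (hfb i),
    ae_all_iff.2 fun i => Linf.coeFn_mul (chi m hA) (Linf.ofBounded m _ (hfm i) (hfb i)),
    coeFn_chi (m := m) hA, Linf.coeFn_zero (m := m)] with x h1 h2 h3 h4 h5 hxA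
  have hcx : c x = 0 := by
    funext i
    have h6 := h3 i
    rw [hrel i, h5, h4, h2, Set.indicator_of_mem hxA, one_mul] at h6
    exact (mul_eq_zero.1 h6.symm).resolve_left (inv_ne_zero (hnorm x).ne')
  have h6 := (hc x).2 hcx
  simpa only [h1, if_false] using h6

end PreNMod

/-! ### The bundle of a proper module -/

namespace PreNMod

variable {m : Measure X} {p : ℝ≥0∞} [Fact (1 ≤ p)]

/-- For a measurable dimension function `dim`, a family `basis n` of `n` elements of `M` for each
`n`, such that for a.e. `x` the elements of `basis (dim x)` induce a norm on `ℝ^(dim x)`, and every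
element of `M` is locally an `L^∞`-combination of them. In `exists_coeff`, the index `k` numbers the
pieces of the partition in the definition of spanning. -/
structure LocalBasis (M : PreNMod m p) where
  dim : X → ℕ
  measurable_dim : Measurable dim
  basis : ∀ n, Fin n → M
  ae_eq_zero : ∀ᵐ x ∂m, ∀ c, M.fiberNorm (basis (dim x)) x c = 0 → c = 0
  exists_coeff : ∀ w : M, ∃ f : ∀ n, ℕ → Fin n → Linf m, ∀ᵐ x ∂m, ∃ k,
    M.pnorm (w - ∑ i, f (dim x) k i • basis (dim x) i) x = 0

lemma IsProper.nonempty_localBasis [SigmaFinite m] {M : PreNMod m p} (h : M.IsProper) :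
    Nonempty M.LocalBasis := by
  classical
  obtain ⟨E, hE, hE0⟩ := h
  obtain ⟨d, hd, hd'⟩ := exists_measurable_index (fun n : ℕ => E n) fun n => hE.measurableSet n
  have hmem : ∀ᵐ x ∂m, x ∈ E (d x) := by
    filter_upwards [measure_eq_zero_iff_ae_notMem.1 hE0] with x hx
    have hxU : x ∈ ⋃ n, E n := by rw [hE.iUnion_eq]; trivial
    obtain ⟨e, he⟩ := Set.mem_iUnion.1 hxU
    induction e using ENat.recTopCoe with
    | top => exact (hx he).elim
    | coe n => exact hd' x n he
  -- on negligible pieces no basis is available, and any family will do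
  have hv : ∀ n : ℕ, ∃ v : Fin n → M, 0 < m (E n) →
      M.IndependentOn v (hE.measurableSet n) ∧ M.SpansOn v (E n) := fun n => by
    by_cases hn : 0 < m (E n)
    · exact (hE.hasDimOn n hn).imp fun _ h _ => h
    · exact ⟨0, fun h => (hn h).elim⟩
  choose v hv using hv
  have hnull : ∀ n : ℕ, ¬ 0 < m (E n) → ∀ᵐ x ∂m, x ∉ E n := fun n hn =>
    measure_eq_zero_iff_ae_notMem.1 (by simpa using hn)
  refine ⟨⟨d, hd, v, ?_, fun w => ?_⟩⟩
  · have h1 : ∀ᵐ x ∂m, ∀ n : ℕ, x ∈ E n → ∀ c, M.fiberNorm (v n) x c = 0 → c = 0 := by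
      refine ae_all_iff.2 fun n => ?_
      by_cases hn : 0 < m (E n)
      · exact (hv n hn).1.ae_fiberNorm_eq_zero
      · exact (hnull n hn).mono fun x hx hx' => (hx hx').elim
    filter_upwards [h1, hmem] with x h1 h2
    exact h1 _ h2
  · have h1 : ∀ n : ℕ, ∃ f : ℕ → Fin n → Linf m, ∀ᵐ x ∂m, x ∈ E n → ∃ k,
        M.pnorm (w - ∑ i, f k i • v n i) x = 0 := by
      intro n
      by_cases hn : 0 < m (E n)
      swap
      · exact ⟨0, (hnull n hn).mono fun x hx hx' => (hx hx').elim⟩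
      obtain ⟨B, hB, -, hU, hf⟩ := (hv n hn).2 w
      choose f hf using hf
      refine ⟨f, ?_⟩
      filter_upwards [ae_all_iff.2 fun k => (M.chi_smul_eq_iff (hB k)).1 (hf k)] with x hx hxE
      rw [← hU] at hxE
      exact (Set.mem_iUnion.1 hxE).imp fun k hk => hx k hk
    choose f hf using h1
    refine ⟨f, ?_⟩
    filter_upwards [ae_all_iff.2 hf, hmem] with x h2 h3
    exact h2 _ h3

namespace LocalBasis

variable {M : PreNMod m p} (b : M.LocalBasis)

/-- The norm `c ↦ |∑ cᵢ vᵢ|(x)` on `ℝ^(dim x)`. -/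
def fnorm (x : X) : (Fin (b.dim x) → ℝ) → ℝ := M.fiberNorm (b.basis (b.dim x)) x

/-- The section `s` represents `w ∈ M`: at a.e. `x` the distance from `w` to each rational
combination of the basis is at most the distance of the coordinates in the fibre. -/
def Represents (s : ∀ x, Fin (b.dim x) → ℝ) (w : M) : Prop :=
  ∀ᵐ x ∂m, ∀ q : Fin (b.dim x) → ℚ, M.pnorm (w - M.ratComb (b.basis (b.dim x)) q) x ≤
    b.fnorm x (fun i => s x i - q i)

lemma Represents.ae_congr {b : M.LocalBasis} {s t : ∀ x, Fin (b.dim x) → ℝ} {w : M}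
    (h : b.Represents s w) (hst : ∀ᵐ x ∂m, s x = t x) : b.Represents t w := by
  filter_upwards [h, hst] with x h1 h2
  rwa [← h2]

variable [SigmaFinite m]

lemma ae_isSeminormFun_fnorm : ∀ᵐ x ∂m, IsSeminormFun (b.fnorm x) := by
  filter_upwards [ae_all_iff.2 fun n => M.ae_isSeminormFun_fiberNorm (b.basis n)] with x hx
  exact hx _

/-- The measurable Banach bundle with fibres `ℝ^(dim x)` normed by `c ↦ |∑ cᵢ vᵢ|(x)`. -/
def bundle : MBB m where
  dim := b.dim
  measurable_dim := b.measurable_dim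
  nrm t := b.fnorm t.base t.vec
  measurable_nrm := by
    refine Total.measurable_of_incl fun n => ?_
    have : ((fun t : Total b.dim => b.fnorm t.base t.vec) ∘
        Total.incl b.dim n) = fun z => M.fiberNorm (b.basis n) z.1.1 z.2 := by
      funext ⟨⟨x, hx⟩, c⟩
      subst hx
      rfl
    rw [this]
    exact M.measurable_fiberNorm _ (measurable_subtype_coe.comp measurable_fst) measurable_snd
  nrm_nonneg t := ratExtend_nonneg _ _
  ae_isNormFun := by
    filter_upwards [b.ae_eq_zero, b.ae_isSeminormFun_fnorm] with x h1 h2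
    exact ⟨h2.add_le, h2.smul_eq, h1⟩

variable {b}

lemma ae_fnorm_ratCast (b : M.LocalBasis) : ∀ᵐ x ∂m, ∀ q : Fin (b.dim x) → ℚ,
    b.fnorm x (fun i => (q i : ℝ)) = M.pnorm (M.ratComb (b.basis (b.dim x)) q) x := by
  filter_upwards [ae_all_iff.2 fun n => M.ae_isRatSeminorm (b.basis n)] with x hx q
  exact (hx _).ratExtend_eq q

namespace Represents

variable {s t : ∀ x, Fin (b.dim x) → ℝ} {w w' : M}

lemma ae_pnorm_eq (h : b.Represents s w) :
    ∀ᵐ x ∂m, M.pnorm w x = b.fnorm x (s x) := by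
  have h2 := ae_all_iff.2 fun n => ae_all_iff.2 fun q =>
    M.ae_le_add_sub w (M.ratComb (b.basis n) q)
  have h3 := ae_all_iff.2 fun n => ae_all_iff.2 fun q =>
    M.ae_le_add_sub (M.ratComb (b.basis n) q) w
  have h4 := ae_all_iff.2 fun n => ae_all_iff.2 fun q =>
    M.ae_sub_rev (M.ratComb (b.basis n) q) w
  filter_upwards [h, h2, h3, h4, b.ae_fnorm_ratCast, b.ae_isSeminormFun_fnorm]
    with x h h2 h3 h4 h5 hs
  have hc := hs.continuous
  refine le_antisymm ?_ ?_
  · have := le_of_forall_rat (a := M.pnorm w x)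
      (F := fun c => b.fnorm x c + b.fnorm x (s x - c))
      (hc.add (hc.comp (continuous_const.sub continuous_id)))
      (fun q => by
        have := h2 _ q
        rw [h5]
        exact this.trans (by gcongr; exact h q)) (s x)
    simpa [hs.map_zero] using this
  · have := le_of_forall_rat (a := -M.pnorm w x)
      (F := fun c => b.fnorm x (s x - c) - b.fnorm x c)
      ((hc.comp (continuous_const.sub continuous_id)).sub hc)
      (fun q => by
        have h6 : _ ≤ b.fnorm x (s x - fun i => (q i : ℝ)) := h q
        have h7 := h3 _ q
        have h8 := h4 _ q
        rw [h5]
        linarith) (s x)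
    simp only [sub_self, hs.map_zero] at this
    linarith

lemma eq (h : b.Represents s w) (h' : b.Represents s w') : w = w' := by
  rw [M.eq_iff_ae]
  have h2 := ae_all_iff.2 fun n => ae_all_iff.2 fun q =>
    M.ae_sub_le w (M.ratComb (b.basis n) q) w'
  have h3 := ae_all_iff.2 fun n => ae_all_iff.2 fun q =>
    M.ae_sub_rev (M.ratComb (b.basis n) q) w'
  filter_upwards [h, h', h2, h3, b.ae_isSeminormFun_fnorm, M.ae_nonneg (w - w')]
    with x h h' h2 h3 hs h0
  have hc := hs.continuous
  have := le_of_forall_rat (a := M.pnorm (w - w') x)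
      (F := fun c => b.fnorm x (s x - c) + b.fnorm x (s x - c))
      ((hc.comp (continuous_const.sub continuous_id)).add
        (hc.comp (continuous_const.sub continuous_id)))
      (fun q => by
        have h4 : _ ≤ b.fnorm x (s x - fun i => (q i : ℝ)) := h q
        have h5 : _ ≤ b.fnorm x (s x - fun i => (q i : ℝ)) := h' q
        have h6 := h2 _ q
        have h7 := h3 _ q
        linarith) (s x)
  simp only [sub_self, hs.map_zero, add_zero] at this
  exact le_antisymm this h0

lemma add (h : b.Represents s w) (h' : b.Represents t w') :
    b.Represents (s + t) (w + w') := by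
  have h2 := ae_all_iff.2 fun n => ae_all_iff.2 fun q => ae_all_iff.2 fun r =>
    M.ae_add_le (w - M.ratComb (b.basis n) r) (w' - M.ratComb (b.basis n) (q - r))
  filter_upwards [h, h', h2, b.ae_isSeminormFun_fnorm] with x h h' h2 hs q
  have hc := hs.continuous
  have := le_of_forall_rat (a := M.pnorm (w + w' - M.ratComb (b.basis (b.dim x)) q) x)
      (F := fun c => b.fnorm x (s x - c) +
        b.fnorm x (t x - ((fun i => (q i : ℝ)) - c)))
      ((hc.comp (continuous_const.sub continuous_id)).add
        (hc.comp (continuous_const.sub (continuous_const.sub continuous_id))))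
      (fun r => by
        have h3 : _ ≤ b.fnorm x (s x - fun i => (r i : ℝ)) := h r
        have h4 := h' (q - r)
        have h5 := h2 _ q r
        rw [sub_add_sub_comm, ← ratComb_add, add_sub_cancel] at h5
        have h6 : (fun i => t x i - ((q - r) i : ℚ)) =
            t x - ((fun i => (q i : ℝ)) - fun i => (r i : ℝ)) := by
          funext i; simp
        rw [h6] at h4
        linarith) (s x)
  simp only [sub_self, hs.map_zero, zero_add] at this
  have h7 : (fun i => (s + t) x i - (q i : ℝ)) = t x - ((fun i => (q i : ℝ)) - s x) := by
    funext i; simp only [Pi.add_apply, Pi.sub_apply]; ring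
  rwa [h7]

lemma smul (f : Linf m) (h : b.Represents s w) :
    b.Represents (fun x => f.1 x • s x) (f • w) := by
  have h1 := ae_all_iff.2 fun n => ae_all_iff.2 fun r : Fin n → ℚ =>
    M.ae_pnorm_sum_smul_sub_ratComb (b.basis n) fun i => f * Linf.const m (r i : ℝ)
  have h2 := ae_all_iff.2 fun n => ae_all_iff.2 fun q => ae_all_iff.2 fun r =>
    M.ae_sub_le (f • w) (f • M.ratComb (b.basis n) r) (M.ratComb (b.basis n) q)
  have h3 := ae_all_iff.2 fun n => ae_all_iff.2 fun r =>
    M.ae_smul f (w - M.ratComb (b.basis n) r)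
  have h4 := ae_all_iff.2 fun r : ℚ => Linf.coeFn_mul f (Linf.const m (r : ℝ))
  have h5 := ae_all_iff.2 fun r : ℚ => Linf.coeFn_const (m := m) (r : ℝ)
  filter_upwards [h, h1, h2, h3, h4, h5, b.ae_isSeminormFun_fnorm]
    with x h h1 h2 h3 h4 h5 hs q
  have hc := hs.continuous
  have := le_of_forall_rat (a := M.pnorm (f • w - M.ratComb (b.basis (b.dim x)) q) x)
      (F := fun c => |f.1 x| * b.fnorm x (s x - c) +
        b.fnorm x (f.1 x • c - fun i => (q i : ℝ)))
      ((continuous_const.mul (hc.comp (continuous_const.sub continuous_id))).add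
        (hc.comp (by fun_prop : Continuous fun c : Fin (b.dim x) → ℝ =>
          f.1 x • c - fun i => (q i : ℝ))))
      (fun r => by
        have h6 : _ ≤ b.fnorm x (s x - fun i => (r i : ℝ)) := h r
        have h7 := h3 _ r
        rw [smul_sub] at h7
        have h8 := h1 _ r q
        simp only [h4, h5, mul_smul, ← Finset.smul_sum] at h8
        have h9 := h2 _ q r
        refine h9.trans (add_le_add ?_ (le_of_eq h8))
        rw [h7]
        exact mul_le_mul_of_nonneg_left h6 (abs_nonneg _)) (s x)
  simp only [sub_self, hs.map_zero, mul_zero, zero_add] at this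
  exact this

end Represents


end LocalBasis

end PreNMod

/-! ### The section functor is essentially surjective -/

namespace PreNMod

variable {m : Measure X} {p : ℝ≥0∞} [Fact (1 ≤ p)]

namespace LocalBasis

open MBB

variable [SigmaFinite m] {M : PreNMod m p} (b : M.LocalBasis)

lemma exists_section_represents (w : M) :
    ∃ s : gammaObj b.bundle p, b.Represents (ev s) w := by
  classical
  obtain ⟨f, hf⟩ := b.exists_coeff w
  have hBm : ∀ n k, MeasurableSet {x | M.pnorm (w - ∑ i, f n k i • b.basis n i) x = 0} :=
    fun n k => M.measurable_pnorm _ (measurableSet_singleton 0)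
  choose k hk hk' using fun n => exists_measurable_index _ (hBm n)
  let s : ∀ x, b.bundle.Fiber x := fun x i => (f (b.dim x) (k (b.dim x) x) i).1 x
  have hsm : Measurable fun x => (⟨x, s x⟩ : Total b.bundle.dim) := by
    refine measurable_section_of_coords (F := fun i x =>
      (fun (n : ℕ) x => if h : i < n then (f n (k n x) ⟨i, h⟩).1 x else 0) (b.dim x) x)
      (fun i => ?_) fun x i => ?_
    · refine measurable_apply_index (F := fun (n : ℕ) x =>
        if h : i < n then (f n (k n x) ⟨i, h⟩).1 x else 0) (fun n => ?_) b.measurable_dim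
      by_cases h : i < n
      · simp only [h, dite_true]
        exact measurable_apply_index (F := fun j x => (f n j ⟨i, h⟩).1 x)
          (fun j => Linf.measurable _) (hk n)
      · simp only [h, dite_false]
        exact measurable_const
    · have : (i : ℕ) < b.dim x := i.2
      simp only [this, dite_true]
      rfl
  have hrep : b.Represents s w := by
    have h1 := ae_all_iff.2 fun n => ae_all_iff.2 fun k =>
      M.ae_pnorm_sum_smul_sub_ratComb (b.basis n) (f n k)
    have h2 := ae_all_iff.2 fun n => ae_all_iff.2 fun k => ae_all_iff.2 fun q =>
      M.ae_sub_le w (∑ i, f n k i • b.basis n i) (M.ratComb (b.basis n) q)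
    filter_upwards [hf, h1, h2] with x hf h1 h2 q
    obtain ⟨j, hj⟩ := hf
    have h3 : M.pnorm (w - ∑ i, f (b.dim x) (k (b.dim x) x) i • b.basis (b.dim x) i) x = 0 :=
      hk' (b.dim x) x j hj
    have h4 := h2 _ (k (b.dim x) x) q
    rw [h3, zero_add, h1] at h4
    exact h4
  have hmem : MemLp (fun x => b.bundle.nrm ⟨x, s x⟩) p m :=
    (memLp_congr_ae hrep.ae_pnorm_eq).1 (Lp.memLp (M.pnorm w))
  exact ⟨ofSection s hsm hmem, hrep.ae_congr (ev_ofSection.mono fun x hx => hx.symm)⟩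

/-- On the pieces of a countable partition where the dimension is constant and the coordinates of
`s` are bounded, `s` defines elements of `M`; these are glued along the partition. -/
lemma exists_represents (hM : M.Glueing) (s : gammaObj b.bundle p) :
    ∃ w : M, b.Represents (ev s) w := by
  classical
  let c : ℕ → X → ℝ := fun i x => Total.coord i (⟨x, ev s x⟩ : Total b.bundle.dim)
  have hcm : ∀ i, Measurable (c i) := measurable_coord_section (measurable_ev s)
  let k : X → ℕ := fun x => ⌈∑ i ∈ Finset.range (b.dim x), |c i x|⌉₊
  have hkm : Measurable k :=
    (measurable_apply_index (F := fun n x => ∑ i ∈ Finset.range n, |c i x|)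
      (fun n => Finset.measurable_fun_sum _ fun i _ => (hcm i).abs) b.measurable_dim).nat_ceil
  let A : ℕ → ℕ → Set X := fun n l => {x | b.dim x = n ∧ k x = l}
  have hA : ∀ n l, MeasurableSet (A n l) := fun n l =>
    (b.measurable_dim (measurableSet_singleton n)).inter (hkm (measurableSet_singleton l))
  have hbd : ∀ n l (i : Fin n), ∃ C, ∀ x, |(A n l).indicator (c i) x| ≤ C := by
    refine fun n l i => ⟨l, fun x => ?_⟩
    by_cases hx : x ∈ A n l
    · obtain ⟨rfl, rfl⟩ := hx
      rw [Set.indicator_of_mem (show x ∈ A (b.dim x) (k x) from ⟨rfl, rfl⟩)]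
      exact (Finset.single_le_sum (f := fun i => |c i x|) (fun _ _ => abs_nonneg _)
        (Finset.mem_range.2 i.2)).trans (Nat.le_ceil _)
    · simp [hx]
  let f : ∀ n, ℕ → Fin n → Linf m := fun n l i =>
    Linf.ofBounded m _ ((hcm i).indicator (hA n l)) (hbd n l i)
  let u : ℕ → ℕ → M := fun n l => ∑ i, f n l i • b.basis n i
  have hf : ∀ᵐ x ∂m, ∀ i, (f (b.dim x) (k x) i).1 x = ev s x i := by
    have h := ae_all_iff.2 fun n => ae_all_iff.2 fun l => ae_all_iff.2 fun i : Fin n =>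
      Linf.coeFn_ofBounded (m := m) ((hcm i).indicator (hA n l)) (hbd n l i)
    filter_upwards [h] with x hx i
    refine (hx _ _ i).trans ?_
    rw [Set.indicator_of_mem (show x ∈ A (b.dim x) (k x) from ⟨rfl, rfl⟩)]
    exact coord_apply (T := b.bundle) _ _ _
  have hu : ∀ᵐ x ∂m, M.pnorm (u (b.dim x) (k x)) x = b.fnorm x (ev s x) := by
    filter_upwards [hf, ae_all_iff.2 fun n => ae_all_iff.2 fun l =>
      M.ae_pnorm_sum_smul (b.basis n) (f n l)] with x h1 h2
    refine (h2 _ _).trans ?_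
    simp only [h1]
    rfl
  -- the pieces, enumerated by a single index
  let A' : ℕ → Set X := fun j => A j.unpair.1 j.unpair.2
  let u' : ℕ → M := fun j => u j.unpair.1 j.unpair.2
  have hA' : ∀ j, MeasurableSet (A' j) := fun j => hA _ _
  have hmemA : ∀ x j, x ∈ A' j → j = Nat.pair (b.dim x) (k x) := fun x j hj => by
    rw [hj.1, hj.2, Nat.pair_unpair]
  have hbound : ∀ N, ‖∑ j ∈ Finset.range N, chi m (hA' j) • u' j‖ ≤ ‖s‖ := by
    intro N
    rw [M.norm_eq, (gammaObj b.bundle p).norm_eq]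
    refine Lp.norm_le_norm_of_ae_le ?_
    filter_upwards [M.ae_sum_le (Finset.range N) fun j => chi m (hA' j) • u' j,
      ae_all_iff.2 fun j => M.ae_chi_smul (hA' j) (u' j), hu, pnorm_ev s,
      M.ae_nonneg (∑ j ∈ Finset.range N, chi m (hA' j) • u' j)] with x h1 h2 h3 h4 h5
    rw [h4, Real.norm_of_nonneg h5, Real.norm_of_nonneg (b.bundle.nrm_nonneg _)]
    refine h1.trans ?_
    simp only [h2]
    have hother : ∀ j, j ≠ Nat.pair (b.dim x) (k x) →
        (A' j).indicator (fun x => M.pnorm (u' j) x) x = 0 := fun j hj =>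
      Set.indicator_of_notMem (fun hx => hj (hmemA x j hx)) _
    by_cases hN : Nat.pair (b.dim x) (k x) ∈ Finset.range N
    · rw [Finset.sum_eq_single_of_mem _ hN fun j _ hj => hother j hj]
      have h6 : x ∈ A' (Nat.pair (b.dim x) (k x)) := by
        simp only [A', Nat.unpair_pair]
        exact ⟨rfl, rfl⟩
      rw [Set.indicator_of_mem h6]
      simp only [u', Nat.unpair_pair]
      exact h3.le
    · rw [Finset.sum_eq_zero fun j hj => hother j fun h => hN (h ▸ hj)]
      exact b.bundle.nrm_nonneg _
  have hdisj : Pairwise fun i j => Disjoint (A' i) (A' j) := fun i j hij =>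
    Set.disjoint_left.2 fun x hi hj => hij ((hmemA x i hi).trans (hmemA x j hj).symm)
  obtain ⟨w, hw, -⟩ := hM u' A' hA' hdisj ‖s‖ hbound
  refine ⟨w, ?_⟩
  have h1 : ∀ᵐ x ∂m, M.pnorm (w - u (b.dim x) (k x)) x = 0 := by
    filter_upwards [ae_all_iff.2 fun j => (M.chi_smul_eq_iff (hA' j)).1 (hw j)] with x hx
    have h2 := hx (Nat.pair (b.dim x) (k x))
    simp only [A', u', Nat.unpair_pair] at h2
    exact h2 ⟨rfl, rfl⟩
  have h2 := ae_all_iff.2 fun n => ae_all_iff.2 fun l => ae_all_iff.2 fun q =>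
    M.ae_sub_le w (u n l) (M.ratComb (b.basis n) q)
  have h3 := ae_all_iff.2 fun n => ae_all_iff.2 fun l =>
    M.ae_pnorm_sum_smul_sub_ratComb (b.basis n) (f n l)
  filter_upwards [h1, h2, h3, hf] with x h1 h2 h3 hf q
  have h4 := h2 _ (k x) q
  rw [h1, zero_add] at h4
  refine h4.trans (le_of_eq ((h3 _ _ q).trans ?_))
  simp only [hf]
  rfl

end LocalBasis

/-- A bijective linear map which preserves the pointwise norm is an isomorphism. -/
def isoOfBijective {M N : PreNMod m p} (L : M →ₗ[Linf m] N) (hL : Function.Bijective L)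
    (h : ∀ v, N.pnorm (L v) = M.pnorm v) : M ≅ N where
  hom := ⟨L, fun v => (h v).le⟩
  inv := ⟨(LinearEquiv.ofBijective L hL).symm.toLinearMap, fun w => by
    rw [← h]
    exact le_of_eq (congrArg N.pnorm ((LinearEquiv.ofBijective L hL).apply_symm_apply w))⟩
  hom_inv_id := Hom.ext (LinearMap.ext fun v =>
    (LinearEquiv.ofBijective L hL).symm_apply_apply v)
  inv_hom_id := Hom.ext (LinearMap.ext fun v =>
    (LinearEquiv.ofBijective L hL).apply_symm_apply v)

/-- A module with the glueing property is the module of sections of the bundle of any of its local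
bases. -/
lemma LocalBasis.nonempty_iso [SigmaFinite m] {M : PreNMod m p} (b : M.LocalBasis)
    (hM : M.Glueing) : Nonempty (MBB.gammaObj b.bundle p ≅ M) := by
  choose Φ hΦ using b.exists_represents hM
  let L : MBB.gammaObj b.bundle p →ₗ[Linf m] M :=
    { toFun := Φ
      map_add' := fun s t => ((hΦ (s + t)).ae_congr (MBB.ev_add s t)).eq ((hΦ s).add (hΦ t))
      map_smul' := fun f s => ((hΦ (f • s)).ae_congr (MBB.ev_smul f s)).eq ((hΦ s).smul f) }
  have hL : ∀ s, M.pnorm (L s) = (MBB.gammaObj b.bundle p).pnorm s := fun s => by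
    refine Lp.ext ?_
    filter_upwards [(hΦ s).ae_pnorm_eq, MBB.pnorm_ev s] with x h1 h2
    exact h1.trans h2.symm
  refine ⟨isoOfBijective L ⟨?_, fun w => ?_⟩ hL⟩
  · refine (injective_iff_map_eq_zero L).2 fun s hs => ?_
    rw [← norm_eq_zero, PreNMod.norm_eq, ← hL, ← M.norm_eq, hs, norm_zero]
  · obtain ⟨s, hs⟩ := b.exists_section_represents w
    exact ⟨s, (hΦ s).eq hs⟩

end PreNMod

end NormedModules

end


theorem mainTheorem4 {X : Type u} [MetricSpace X] [CompleteSpace X]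
    [TopologicalSpace.SeparableSpace X] [MeasurableSpace X] [BorelSpace X]
    (m : MeasureTheory.Measure X) [MeasureTheory.IsLocallyFiniteMeasure m] (hm : m ≠ 0)
    (p : ℝ≥0∞) [Fact (1 ≤ p)] :
    ∃ h : ∀ T : NormedModules.MBB m,
        NormedModules.isProperNMod m p ((NormedModules.sectionFunctor m p).obj T),
      ((NormedModules.isProperNMod m p).lift (NormedModules.sectionFunctor m p) h :
        NormedModules.MBB m ⥤ NormedModules.NModPr m p).IsEquivalence := by
  have : SecondCountableTopology X := UniformSpace.secondCountable_of_separable X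
  have h : ∀ T : NormedModules.MBB m,
      NormedModules.isProperNMod m p ((NormedModules.sectionFunctor m p).obj T) :=
    fun T => NormedModules.MBB.isProperNMod_gammaObj T p
  refine ⟨h, ?_⟩
  exact
    { faithful := inferInstance
      full := inferInstance
      essSurj := ⟨fun M => by
        obtain ⟨b⟩ := M.property.2.nonempty_localBasis
        obtain ⟨e⟩ := b.nonempty_iso M.property.1.glueing
        exact ⟨b.bundle, ⟨ObjectProperty.isoMk _ e⟩⟩⟩ }
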